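/- Let $J$ be a Euclidean Jordan algebra (finite-dimensional, with unit element $e$ and an associative inner product), with multiplication operators $L(x)y=xy$ and quadratic representation $P(x)=2L(x)^2-L(x^2)$. Let $\mathrm{Str}(J)$ be its structure group, i.e. the group of all $\ell\in GL(J)$ that preserve the set $J^\times$ of invertible elements and for which there is $h\in GL(J)$ with $(\ell x)^{-1}=h\,x^{-1}$ for all $x\in J^\times$; let $L$ be the neutral component of $\mathrm{Str}(J)$, and let $\Omega=\{y^2 : y\in J^\times\}$ be the symmetric cone of $J$. Let $\mathbf c=(c_1,\dots,c_k)$ be a complete system of orthogonal idempotents of $J$: $c_j^2=c_j$, $c_ic_j=0$ for $i\ne j$, and $c_1+\dots+c_k=e$. Let $J_j=\{x\in J : c_jx=x\}$, which is a Euclidean Jordan algebra with unit element $c_j$, let $L_j$ be the neutral component of $\mathrm{Str}(J_j)$, and put $J(\mathbf c)=J_1\oplus\dots\oplus J_k$ and $\Omega(\mathbf c)=J(\mathbf c)\cap\Omega$. Let $L(\mathbf c)$ be the neutral component of $\mathrm{Str}(\mathbf c)=\{\ell\in\mathrm{Str}(J) : \ell(J(\mathbf c))=J(\mathbf c)\}$,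 and let $M(\mathbf c)=\{\ell\in L(\mathbf c) : \ell x=x \text{ for all } x\in J(\mathbf c)\}$. Then: (i) Every $\ell\in L(\mathbf c)$ maps each $J_j$ into itself and induces on it an element $\ell_j$ of $L_j$, and the restriction map $L(\mathbf c)\to L_1\times\dots\times L_k$, $\ell\mapsto(\ell_1,\dots,\ell_k)$, is a surjective homomorphism. (ii) The kernel of the restriction map is $M(\mathbf c)$. (iii) $L(\mathbf c)\subset L$, $P(x)\in L(\mathbf c)$ for every $x\in\Omega(\mathbf c)$, and $L(\mathbf c)$ is the closed subgroup of $L$ generated by $\{P(x) : x\in\Omega(\mathbf c)\}$ and $M(\mathbf c)$. -/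

import Mathlib

/-- A Euclidean Jordan algebra: a finite-dimensional real inner product space with a commutative
bilinear product satisfying the Jordan identity `(x y) x² = x (y x²)`, a unit element, and such
that every multiplication operator is symmetric for the inner product. -/
class EuclideanJordanAlgebra (J : Type*) [NormedAddCommGroup J] [InnerProductSpace ℝ J] extends
    CommMagma J, MulOneClass J, IsCommJordan J, Module.Finite ℝ J where
  add_mul' : ∀ x y z : J, (x + y) * z = x * z + y * z
  smul_mul' : ∀ (t : ℝ) (x y : J), (t • x) * y = t • (x * y)
  inner_mul' : ∀ x y z : J, inner ℝ (x * y) z = inner ℝ y (x * z)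

namespace EuclideanJordanAlgebra

section Basic

variable {J : Type*} [NormedAddCommGroup J] [InnerProductSpace ℝ J] [EuclideanJordanAlgebra J]

/-- The multiplication operator `L(x) : y ↦ x y`. -/
def mulOp (x : J) : J →ₗ[ℝ] J where
  toFun y := x * y
  map_add' y z := by
    rw [mul_comm x (y + z), add_mul', mul_comm y x, mul_comm z x]
  map_smul' t y := by
    rw [mul_comm x (t • y), smul_mul', mul_comm y x, RingHom.id_apply]

/-- The quadratic representation `P(x) = 2 L(x)² - L(x²)`. -/
def quadRep (x : J) : J →ₗ[ℝ] J :=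
  (2 : ℝ) • (mulOp x ∘ₗ mulOp x) - mulOp (x * x)

/-- `ℝ[x]`, the linear span of the powers `x⁰ = e`, `xⁿ⁺¹ = x xⁿ`. -/
def powerSpan (x : J) : Submodule ℝ J :=
  Submodule.span ℝ (Set.range fun n : ℕ => (fun y : J => x * y)^[n] 1)

/-- `x` is invertible: there is `y ∈ ℝ[x]` with `x y = e` (such a `y` is unique, since `ℝ[x]` is
an associative algebra). -/
def IsInvertible (x : J) : Prop :=
  ∃ y ∈ powerSpan x, x * y = 1

open Classical in
/-- The inverse `x⁻¹` of an invertible element (and `0` for other elements). -/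
noncomputable def jinv (x : J) : J :=
  if h : IsInvertible x then h.choose else 0

variable (J) in
/-- `GL(J)`, with the topology induced by the operator norm. -/
abbrev GLin : Type _ := (J →L[ℝ] J)ˣ

variable (J) in
/-- The structure group `Str(J)`: those `ℓ ∈ GL(J)` that preserve the set of invertible elements
and for which there is `h ∈ GL(J)` with `(ℓ x)⁻¹ = h x⁻¹` for all invertible `x`. -/
def structureGroup : Subgroup (GLin J) where
  carrier := {l | (∀ x : J, IsInvertible (l.val x) ↔ IsInvertible x) ∧
    ∃ h : GLin J, ∀ x : J, IsInvertible x → jinv (l.val x) = h.val (jinv x)}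
  one_mem' := ⟨fun _ => Iff.rfl, 1, fun _ _ => rfl⟩
  mul_mem' := by
    rintro a b ⟨ha, h, hh⟩ ⟨hb, h', hh'⟩
    refine ⟨fun x => (ha (b.val x)).trans (hb x), h * h', fun x hx => ?_⟩
    change jinv (a.val (b.val x)) = h.val (h'.val (jinv x))
    rw [hh _ ((hb x).2 hx), hh' x hx]
  inv_mem' := by
    rintro a ⟨ha, h, hh⟩
    have key : ∀ x : J, a.val (a⁻¹.val x) = x := fun x =>
      congrArg (fun f : J →L[ℝ] J => f x) a.mul_inv
    have hinv : ∀ x : J, IsInvertible (a⁻¹.val x) ↔ IsInvertible x := fun x => by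
      rw [← ha (a⁻¹.val x), key]
    refine ⟨hinv, h⁻¹, fun x hx => ?_⟩
    have h1 := hh (a⁻¹.val x) ((hinv x).2 hx)
    rw [key] at h1
    rw [h1]
    exact (congrArg (fun f : J →L[ℝ] J => f (jinv (a⁻¹.val x))) h.inv_mul).symm

variable (J) in
/-- The symmetric cone `Ω`: the set of squares of invertible elements. -/
def cone : Set J := {x | ∃ y : J, IsInvertible y ∧ x = y * y}

/-- The neutral component of a subgroup `H` of `GL(J)` (for the subspace topology), viewed as a
subgroup of `GL(J)`. -/
noncomputable def neutralComponent (H : Subgroup (GLin J)) : Subgroup (GLin J) :=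
  (Subgroup.connectedComponentOfOne H).map H.subtype

variable (J) in
/-- The group `L`, the neutral component of `Str(J)`. -/
noncomputable def groupL : Subgroup (GLin J) := neutralComponent (structureGroup J)

/-- If `c² = c` and `c x = x`, then `c (x y) = x (c y)`. -/
theorem mul_left_comm_of_idem {c x : J} (hc : c * c = c) (hx : c * x = x) (y : J) :
    c * (x * y) = x * (c * y) := by
  let _ : NonUnitalNonAssocCommRing J :=
    { (inferInstance : AddCommGroup J), (inferInstance : CommMagma J) with
      left_distrib := fun a b d => (mulOp a).map_add b d
      right_distrib := add_mul'
      zero_mul := fun a => by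
        have h := smul_mul' (0 : ℝ) (0 : J) a
        rwa [zero_smul, zero_smul] at h
      mul_zero := fun a => (mulOp a).map_zero }
  have h := two_nsmul_lie_lmul_lmul_add_add_eq_zero x c c
  rw [hc, mul_comm x c, hx, two_nsmul] at h
  have h' := congrArg (fun f : AddMonoid.End J => f y) h
  have h1 : ∀ a b : J, (⁅AddMonoid.End.mulLeft a, AddMonoid.End.mulLeft b⁆ : AddMonoid.End J) y
      = a * (b * y) - b * (a * y) := fun _ _ => rfl
  have h2 : (2 : ℝ) • (c * (x * y) - x * (c * y)) = 0 := by
    change ((⁅AddMonoid.End.mulLeft x, AddMonoid.End.mulLeft c⁆ : AddMonoid.End J) y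
      + (⁅AddMonoid.End.mulLeft c, AddMonoid.End.mulLeft x⁆ : AddMonoid.End J) y
      + (⁅AddMonoid.End.mulLeft c, AddMonoid.End.mulLeft x⁆ : AddMonoid.End J) y)
      + ((⁅AddMonoid.End.mulLeft x, AddMonoid.End.mulLeft c⁆ : AddMonoid.End J) y
      + (⁅AddMonoid.End.mulLeft c, AddMonoid.End.mulLeft x⁆ : AddMonoid.End J) y
      + (⁅AddMonoid.End.mulLeft c, AddMonoid.End.mulLeft x⁆ : AddMonoid.End J) y) = 0 at h'
    simp only [h1] at h'
    rw [← h', two_smul]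
    abel
  exact sub_eq_zero.1 ((smul_eq_zero.1 h2).resolve_left two_ne_zero)

end Basic

/-- A complete system of orthogonal idempotents `(c₁, …, c_k)` of `J`. -/
structure CSOI (J : Type*) [NormedAddCommGroup J] [InnerProductSpace ℝ J]
    [EuclideanJordanAlgebra J] (k : ℕ) where
  elem : Fin k → J
  idem : ∀ j, elem j * elem j = elem j
  orth : ∀ i j, i ≠ j → elem i * elem j = 0
  sum_eq_one : ∑ j, elem j = 1

namespace CSOI

variable {J : Type*} [NormedAddCommGroup J] [InnerProductSpace ℝ J] [EuclideanJordanAlgebra J]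
  {k : ℕ}

/-- `J_j = J(c_j, 1) = {x ∈ J : c_j x = x}`. -/
def component (c : CSOI J k) (j : Fin k) : Submodule ℝ J where
  carrier := {x | c.elem j * x = x}
  add_mem' {x y} hx hy := ((mulOp (c.elem j)).map_add x y).trans (congrArg₂ (· + ·) hx hy)
  zero_mem' := (mulOp (c.elem j)).map_zero
  smul_mem' t x hx := ((mulOp (c.elem j)).map_smul t x).trans (congrArg (t • ·) hx)

/-- `J_j` is a Euclidean Jordan algebra for the product and the inner product of `J`, with unit
element `c_j`. -/
instance instComponent (c : CSOI J k) (j : Fin k) :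
    EuclideanJordanAlgebra (c.component j) where
  mul x y := ⟨x.1 * y.1,
    (mul_left_comm_of_idem (c.idem j) x.2 y.1).trans (congrArg (x.1 * ·) y.2)⟩
  one := ⟨c.elem j, c.idem j⟩
  mul_comm x y := Subtype.ext (mul_comm x.1 y.1)
  one_mul x := Subtype.ext x.2
  mul_one x := Subtype.ext ((mul_comm x.1 (c.elem j)).trans x.2)
  lmul_comm_rmul_rmul x y := Subtype.ext (IsCommJordan.lmul_comm_rmul_rmul x.1 y.1)
  fg_top := (inferInstance : Module.Finite ℝ (c.component j)).fg_top
  add_mul' x y z := Subtype.ext (add_mul' x.1 y.1 z.1)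
  smul_mul' t x y := Subtype.ext (smul_mul' t x.1 y.1)
  inner_mul' x y z := inner_mul' x.1 y.1 z.1

/-- `J(𝐜) = J_1 ⊕ ⋯ ⊕ J_k`, as a subspace of `J`. -/
def subalgebra (c : CSOI J k) : Submodule ℝ J := ⨆ j, c.component j

/-- `Ω(𝐜) = J(𝐜) ∩ Ω`. -/
def cone (c : CSOI J k) : Set J := (c.subalgebra : Set J) ∩ EuclideanJordanAlgebra.cone J

/-- `Str(𝐜) = {ℓ ∈ Str(J) : ℓ(J(𝐜)) = J(𝐜)}`. -/
def structureGroup (c : CSOI J k) : Subgroup (GLin J) where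
  carrier := {l | l ∈ EuclideanJordanAlgebra.structureGroup J ∧
    (fun x => l.val x) '' (c.subalgebra : Set J) = c.subalgebra}
  one_mem' := ⟨one_mem _, Set.image_id _⟩
  mul_mem' := by
    rintro a b ⟨ha, ha'⟩ ⟨hb, hb'⟩
    refine ⟨mul_mem ha hb, ?_⟩
    have h := Set.image_image (fun x => a.val x) (fun x => b.val x) (c.subalgebra : Set J)
    rw [hb', ha'] at h
    exact h.symm
  inv_mem' := by
    rintro a ⟨ha, ha'⟩
    refine ⟨inv_mem ha, ?_⟩
    have h := Set.image_image (fun x => a⁻¹.val x) (fun x => a.val x) (c.subalgebra : Set J)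
    rw [ha'] at h
    rw [h]
    have key : (fun x => a⁻¹.val (a.val x)) = (id : J → J) := funext fun x =>
      congrArg (fun f : J →L[ℝ] J => f x) a.inv_mul
    rw [key, Set.image_id]

/-- `L(𝐜)`, the neutral component of `Str(𝐜)`. -/
noncomputable def groupL (c : CSOI J k) : Subgroup (GLin J) := neutralComponent c.structureGroup

/-- `M(𝐜) = {ℓ ∈ L(𝐜) : ℓ x = x for all x ∈ J(𝐜)}`. -/
noncomputable def groupM (c : CSOI J k) : Subgroup (GLin J) where
  carrier := {l | l ∈ c.groupL ∧ ∀ x ∈ c.subalgebra, l.val x = x}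
  one_mem' := ⟨one_mem _, fun _ _ => rfl⟩
  mul_mem' := by
    rintro a b ⟨ha, ha'⟩ ⟨hb, hb'⟩
    refine ⟨mul_mem ha hb, fun x hx => ?_⟩
    change a.val (b.val x) = x
    rw [hb' x hx, ha' x hx]
  inv_mem' := by
    rintro a ⟨ha, ha'⟩
    refine ⟨inv_mem ha, fun x hx => ?_⟩
    have key : a⁻¹.val (a.val x) = x := congrArg (fun f : J →L[ℝ] J => f x) a.inv_mul
    rwa [ha' x hx] at key

end CSOI

end EuclideanJordanAlgebra

/-! The group Str(J) consists of the ℓ with P(ℓx) = ℓP(x)ℓ⁻¹P(ℓe) for all x. One direction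
(`quadCLM_of_mem`) comes from differentiating (ℓx)⁻¹ = h x⁻¹, since inversion has differential
-P(x)⁻¹. Hence Str(J) is closed, and by the fundamental formula it contains P(x) for every
invertible x.

Surjectivity of the restriction rests on `groupL_le_quadGroup`, applied to each J_j. The equations
of Str(J), linearized at the identity, say that w - L(we) is a derivation; derivations are sums of
commutators [L(x), L(y)] (`mem_innerDer_of_derivation`), and 2L(x) is the velocity of P(e + tx) at t
= 0. So the group generated by the P(x), x ∈ Ω, has a tangent space containing all solutions of the
linearized equations, and the open-mapping argument of `Subgroup.eventually_mem_of_ker_le` makes it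
a neighbourhood of 1 in Str(J).

For ℓ in Str(𝐜), the operator ℓP(c_i)ℓ⁻¹ = P(ℓc_i)P(ℓe)⁻¹ preserves every J_j; if it is close to
P(c_i), then ℓ maps J_i into itself (`map_mem_component`). This holds near 1, hence on the neutral
component. Conversely, P(x) with x ∈ Ω_j extends to P(x + e - c_j), which is the identity on the
other J_i (`exists_extension`). Thus every element of L_1 × ⋯ × L_k lifts to a product of P(x)^{±1},
x ∈ Ω(𝐜), and two lifts differ by an element of M(𝐜). -/

open Filter Topology

namespace EuclideanJordanAlgebra

/-! ### Jordan triple identities and the fundamental formula. -/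

section Algebra

variable {J : Type*} [NormedAddCommGroup J] [InnerProductSpace ℝ J] [EuclideanJordanAlgebra J]

scoped instance instNonUnitalNonAssocCommRing : NonUnitalNonAssocCommRing J :=
  { (inferInstance : AddCommGroup J), (inferInstance : CommMagma J) with
    left_distrib := fun a b d => (mulOp a).map_add b d
    right_distrib := add_mul'
    zero_mul := fun a => by
      have h := smul_mul' (0 : ℝ) (0 : J) a
      rwa [zero_smul, zero_smul] at h
    mul_zero := fun a => (mulOp a).map_zero }

scoped instance instIsScalarTower : IsScalarTower ℝ J J := ⟨fun t x y => smul_mul' t x y⟩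

scoped instance instSMulCommClass : SMulCommClass ℝ J J :=
  ⟨fun t x y => ((mulOp x).map_smul t y).symm⟩

@[simp] theorem mulOp_apply (x y : J) : mulOp x y = x * y := rfl

theorem quadRep_apply (x y : J) : quadRep x y = (2 : ℝ) • (x * (x * y)) - (x * x) * y := rfl

/-- The linearized Jordan identity. -/
theorem mul_mul_mul_add_add (x y z w : J) :
    x * ((y * z) * w) + y * ((z * x) * w) + z * ((x * y) * w)
      = (y * z) * (x * w) + (z * x) * (y * w) + (x * y) * (z * w) := by
  have h := two_nsmul_lie_lmul_lmul_add_add_eq_zero x y z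
  rw [two_nsmul] at h
  have h' := congrArg (fun f : AddMonoid.End J => f w) h
  have h1 : ∀ a b : J, (⁅AddMonoid.End.mulLeft a, AddMonoid.End.mulLeft b⁆ : AddMonoid.End J) w
      = a * (b * w) - b * (a * w) := fun _ _ => rfl
  change (⁅AddMonoid.End.mulLeft x, AddMonoid.End.mulLeft (y * z)⁆ w
    + ⁅AddMonoid.End.mulLeft y, AddMonoid.End.mulLeft (z * x)⁆ w
    + ⁅AddMonoid.End.mulLeft z, AddMonoid.End.mulLeft (x * y)⁆ w)
    + (⁅AddMonoid.End.mulLeft x, AddMonoid.End.mulLeft (y * z)⁆ w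
    + ⁅AddMonoid.End.mulLeft y, AddMonoid.End.mulLeft (z * x)⁆ w
    + ⁅AddMonoid.End.mulLeft z, AddMonoid.End.mulLeft (x * y)⁆ w) = 0 at h'
  simp only [h1] at h'
  rw [← two_smul ℝ] at h'
  have h2 := (smul_eq_zero.1 h').resolve_left two_ne_zero
  rw [← sub_eq_zero, ← h2]
  abel

/-- The commutators `[L(x), L(y)]` are derivations. -/
theorem commutator_mul (x y z w : J) :
    x * (y * (z * w)) - y * (x * (z * w))
      = (x * (y * z) - y * (x * z)) * w + z * (x * (y * w) - y * (x * w)) := by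
  have h1 := mul_mul_mul_add_add y z w x
  have h2 := mul_mul_mul_add_add x z w y
  have f1 := mul_comm (x * (y * z)) w
  have f2 := mul_comm (y * (x * z)) w
  have f3 := mul_comm (y * z) (x * w)
  have f4 := mul_comm (y * w) (x * z)
  simp only [mul_comm (z * w), mul_comm w y, mul_comm (y * z) x, mul_comm w x, mul_comm (x * z) y,
    mul_comm x y, mul_comm (y * w) x, mul_comm (x * w) y, mul_comm z x,
    mul_comm z y, f3, f4] at h1 h2
  rw [sub_mul, mul_sub, f1, f2]
  linear_combination (norm := skip) h2 - h1
  abel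

/-- The Jordan triple product. -/
def triple (x y z : J) : J := (x * y) * z + x * (y * z) - y * (x * z)

theorem triple_comm (x y z : J) : triple x y z = triple z y x := by
  simp only [triple, mul_comm z y, mul_comm z x, mul_comm (y * z) x, mul_comm (x * y) z,
    mul_comm y x]
  abel

theorem quadRep_eq_triple (x y : J) : quadRep x y = triple x y x := by
  simp only [quadRep_apply, triple, mul_comm y x, mul_comm (x * y) x, mul_comm (x * x) y, two_smul]

theorem triple_add_left (x x' y z : J) : triple (x + x') y z = triple x y z + triple x' y z := by
  simp only [triple, add_mul, mul_add]; abel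

theorem triple_add_mid (x y y' z : J) : triple x (y + y') z = triple x y z + triple x y' z := by
  simp only [triple, add_mul, mul_add]; abel

theorem triple_add_right (x y z z' : J) : triple x y (z + z') = triple x y z + triple x y z' := by
  simp only [triple, mul_add]; abel

theorem triple_smul_left (t : ℝ) (x y z : J) : triple (t • x) y z = t • triple x y z := by
  simp only [triple, smul_mul_assoc, mul_smul_comm]; module

theorem triple_smul_mid (t : ℝ) (x y z : J) : triple x (t • y) z = t • triple x y z := by
  simp only [triple, smul_mul_assoc, mul_smul_comm]; module

theorem triple_smul_right (t : ℝ) (x y z : J) : triple x y (t • z) = t • triple x y z := by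
  simp only [triple, mul_smul_comm]; module

theorem commutator_triple (x y u v w : J) :
    x * (y * triple u v w) - y * (x * triple u v w)
      = triple (x * (y * u) - y * (x * u)) v w + triple u (x * (y * v) - y * (x * v)) w
        + triple u v (x * (y * w) - y * (x * w)) := by
  have h : ∀ a b : J, x * (y * (a * b)) = y * (x * (a * b))
      + (x * (y * a) - y * (x * a)) * b + a * (x * (y * b) - y * (x * b)) := fun a b => by
    rw [add_assoc, ← commutator_mul]; abel
  simp only [triple, mul_add, mul_sub, h]
  simp only [add_mul, sub_mul, mul_sub]
  abel

/-- The pair (L(a), -L(a)) acts as a derivation on the triple product, with -L(a) in the middle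
slot. Together with the derivations [L(x), L(y)] this yields the five-linear identity. -/
theorem mul_triple (a u v w : J) :
    a * triple u v w = triple (a * u) v w - triple u (a * v) w + triple u v (a * w) := by
  have h1 := commutator_mul u v a w
  have h2 := mul_mul_mul_add_add a u v w
  have e1 := mul_comm v a
  have e2 := mul_comm (u * v) (a * w)
  have e3 := mul_comm (a * v) (u * w)
  have e4 := mul_comm (a * u) (v * w)
  have e5 := mul_comm u a
  have e7 := mul_comm (a * u) v
  simp only [triple, mul_add, mul_sub, sub_mul, e1, e2, e3, e4, e5, e7] at h1 h2 ⊢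
  linear_combination (norm := skip) h2 - h1
  abel

/-- The five-linear identity of a Jordan triple system. -/
theorem triple_triple (x y u v w : J) :
    triple x y (triple u v w)
      = triple (triple x y u) v w - triple u (triple y x v) w + triple u v (triple x y w) := by
  have h1 := commutator_triple x y u v w
  have h2 := mul_triple (x * y) u v w
  -- The operator {x y ·} is L(xy) + [L(x), L(y)]; exchanging x and y flips only the commutator,
  -- which is why {y x ·} appears in the middle slot.
  have key : ∀ z, triple x y z = (x * y) * z + (x * (y * z) - y * (x * z)) := fun z => by
    rw [triple]; abel
  have key' : ∀ z, triple y x z = (x * y) * z - (x * (y * z) - y * (x * z)) := fun z => by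
    rw [triple, mul_comm y x]; abel
  have hs : ∀ p q r s : J, triple p (q - r) s = triple p q s - triple p r s := fun p q r s => by
    rw [eq_sub_iff_add_eq, ← triple_add_mid, sub_add_cancel]
  rw [key, key u, key', key w, h1, h2, triple_add_left, triple_add_right]
  simp only [hs]
  abel

theorem triple_quadRep_eq (x y v : J) :
    triple x y (quadRep x v) = quadRep x (triple y x v) := by
  have h1 := triple_triple x y x v x
  have h2 := triple_triple x v x y x
  simp only [quadRep_eq_triple]
  rw [triple_comm x v (triple x y x)] at h1
  rw [triple_comm x y (triple x v x), triple_comm v x y] at h2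
  rw [triple_comm x y (triple x v x)] at h1 ⊢
  rw [triple_comm x v (triple x y x)] at h2
  set p := triple (triple x y x) v x
  set q := triple (triple x v x) y x
  set r := triple x (triple y x v) x
  -- The two instances read q = 2p - r and p = 2q - r.
  have h3 : (3 : ℝ) • (q - r) = 0 := by
    linear_combination (norm := module) (-2 : ℝ) • h2 - h1
  exact sub_eq_zero.1 ((smul_eq_zero.1 h3).resolve_left three_ne_zero)

/-- The fundamental formula of the quadratic representation. -/
theorem quadRep_quadRep (x y z : J) :
    quadRep (quadRep x y) z = quadRep x (quadRep y (quadRep x z)) := by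
  have h1 := triple_triple x y x z (quadRep x y)
  have h2 := triple_triple z x y x y
  rw [triple_quadRep_eq x z, triple_quadRep_eq, triple_quadRep_eq x (triple y x z),
    triple_quadRep_eq, triple_quadRep_eq x z, ← quadRep_eq_triple x y,
    ← quadRep_eq_triple (quadRep x y), triple_comm z x y, triple_comm _ x y] at h1
  rw [← quadRep_eq_triple x z, ← quadRep_eq_triple y (quadRep x z), triple_comm z x y,
    triple_comm (triple y x z) x y, ← quadRep_eq_triple y x] at h2
  -- In `h1` all operators {x a ·} have been moved inside P(x). Applying P(x) to the present
  -- equation gives what `h1` says P(P(x)y)z equals.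
  have h3 : quadRep y (quadRep x z) = (2 : ℝ) • triple y x (triple y x z)
      - triple z x (quadRep y x) := by
    linear_combination (norm := module) h2
  rw [h3, map_sub, map_smul]
  rw [← quadRep_eq_triple y x] at h1
  linear_combination (norm := module) - h1

theorem quadRep_one (x : J) : quadRep (1 : J) x = x := by
  simp only [quadRep_apply, one_mul]; module

theorem quadRep_apply_one (x : J) : quadRep x 1 = x * x := by
  simp only [quadRep_apply, mul_one]; module

theorem quadRep_add_smul (x y z : J) (t : ℝ) :
    quadRep (x + t • y) z
      = quadRep x z + (2 * t) • triple x z y + (t * t) • quadRep y z := by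
  simp only [quadRep_eq_triple, triple_add_left, triple_add_right, triple_smul_left,
    triple_smul_right, triple_comm y z x]
  module

/-! ### Power associativity -/

/-- The linearized Jordan identity, read as an equation between operators on one of its repeated
variables. It is a two-step recursion for L(xⁿ); at x = y = c idempotent it becomes 2L(c)³ - 3L(c)²
+ L(c) = 0. -/
theorem mulOp_mul_mul_self (x y : J) :
    mulOp (x * (x * y)) = mulOp (x * x) * mulOp y + (2 : ℝ) • (mulOp (x * y) * mulOp x)
      - mulOp x * mulOp x * mulOp y - mulOp y * mulOp x * mulOp x := by
  ext z
  have h := mul_mul_mul_add_add x y z x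
  simp only [LinearMap.sub_apply, LinearMap.add_apply, Module.End.mul_apply, mulOp_apply,
    LinearMap.smul_apply]
  rw [mul_comm (y * z) x, mul_comm z x, mul_comm (x * z) x, mul_comm (x * y) x,
    mul_comm z (x * (x * y)), mul_comm (y * z) (x * x), mul_comm y x, mul_comm (x * z) (x * y)] at h
  linear_combination (norm := module) h

/-- The powers `xⁿ⁺¹ = x xⁿ`. -/
def power (x : J) (n : ℕ) : J := (fun y : J => x * y)^[n] 1

theorem power_zero (x : J) : power x 0 = 1 := rfl

theorem power_succ (x : J) (n : ℕ) : power x (n + 1) = x * power x n :=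
  Function.iterate_succ_apply' _ _ _

theorem power_one (x : J) : power x 1 = x := mul_one x

theorem power_mem (x : J) (n : ℕ) : power x n ∈ powerSpan x :=
  Submodule.subset_span ⟨n, rfl⟩

theorem one_mem_powerSpan (x : J) : (1 : J) ∈ powerSpan x := power_mem x 0

theorem self_mem_powerSpan (x : J) : x ∈ powerSpan x := by
  have h := power_mem x 1
  rwa [power_one] at h

theorem mulOp_add (x y : J) : mulOp (x + y) = mulOp x + mulOp y :=
  LinearMap.ext fun z => add_mul x y z

theorem mulOp_smul (t : ℝ) (x : J) : mulOp (t • x) = t • mulOp x :=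
  LinearMap.ext fun z => smul_mul_assoc t x z

theorem mulOp_zero : mulOp (0 : J) = 0 := LinearMap.ext fun z => zero_mul z

theorem mulOp_one : mulOp (1 : J) = 1 := LinearMap.ext fun z => one_mul z

theorem commute_mulOp_self_sq (x : J) : Commute (mulOp x) (mulOp (x * x)) := by
  refine LinearMap.ext fun z => ?_
  have h := mul_mul_mul_add_add x x x z
  have h3 : (3 : ℝ) • (x * ((x * x) * z) - (x * x) * (x * z)) = 0 := by
    linear_combination (norm := module) h
  exact sub_eq_zero.1 ((smul_eq_zero.1 h3).resolve_left three_ne_zero)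

/-- Two consecutive powers are carried along because the recursion for L(xⁿ⁺²) involves both L(xⁿ)
and L(xⁿ⁺¹). -/
theorem mulOp_power_mem_adjoin (x : J) (n : ℕ) :
    mulOp (power x n) ∈ Algebra.adjoin ℝ {mulOp x, mulOp (x * x)} ∧
      mulOp (power x (n + 1)) ∈ Algebra.adjoin ℝ {mulOp x, mulOp (x * x)} := by
  have h1 : mulOp x ∈ Algebra.adjoin ℝ {mulOp x, mulOp (x * x)} :=
    Algebra.subset_adjoin (by simp)
  have h2 : mulOp (x * x) ∈ Algebra.adjoin ℝ {mulOp x, mulOp (x * x)} :=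
    Algebra.subset_adjoin (by simp)
  induction n with
  | zero =>
    refine ⟨?_, ?_⟩
    · rw [power_zero, mulOp_one]; exact one_mem _
    · rwa [power_one]
  | succ n ih =>
    refine ⟨ih.2, ?_⟩
    obtain ⟨h3, h4⟩ := ih
    rw [power_succ] at h4
    rw [power_succ, power_succ, mulOp_mul_mul_self]
    exact sub_mem (sub_mem (add_mem (mul_mem h2 h3) (Subalgebra.smul_mem _ (mul_mem h4 h1) _))
      (mul_mem (mul_mem h1 h1) h3)) (mul_mem (mul_mem h3 h1) h1)

theorem mulOp_mem_adjoin {x a : J} (ha : a ∈ powerSpan x) :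
    mulOp a ∈ Algebra.adjoin ℝ {mulOp x, mulOp (x * x)} := by
  induction ha using Submodule.span_induction with
  | mem a ha => obtain ⟨n, rfl⟩ := ha; exact (mulOp_power_mem_adjoin x n).1
  | zero => rw [mulOp_zero]; exact zero_mem _
  | add a b _ _ ha hb => rw [mulOp_add]; exact add_mem ha hb
  | smul t a _ ha => rw [mulOp_smul]; exact Subalgebra.smul_mem _ ha _

/-- Both operators lie in the algebra generated by the commuting pair L(x), L(x²). With
commutativity of the product, this gives associativity of ℝ[x]. -/
theorem commute_mulOp {x a b : J} (ha : a ∈ powerSpan x) (hb : b ∈ powerSpan x) :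
    Commute (mulOp a) (mulOp b) := by
  have hc : ∀ u ∈ ({mulOp x, mulOp (x * x)} : Set (Module.End ℝ J)),
      ∀ v ∈ ({mulOp x, mulOp (x * x)} : Set (Module.End ℝ J)), u * v = v * u := by
    rintro u (rfl | rfl) v (rfl | rfl)
    · rfl
    · exact commute_mulOp_self_sq x
    · exact (commute_mulOp_self_sq x).symm
    · rfl
  have h := (Algebra.isMulCommutative_adjoin ℝ hc).is_comm.comm ⟨_, mulOp_mem_adjoin ha⟩
    ⟨_, mulOp_mem_adjoin hb⟩
  exact congrArg Subtype.val h

theorem mul_left_comm_of_mem {x a b : J} (ha : a ∈ powerSpan x) (hb : b ∈ powerSpan x) (c : J) :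
    a * (b * c) = b * (a * c) :=
  LinearMap.congr_fun (commute_mulOp ha hb) c

theorem mul_assoc_of_mem {x a b c : J} (ha : a ∈ powerSpan x) (hc : c ∈ powerSpan x) :
    (a * b) * c = a * (b * c) := by
  rw [mul_comm (a * b) c, mul_left_comm_of_mem hc ha, mul_comm c b]

theorem mul_mem_powerSpan {x a b : J} (ha : a ∈ powerSpan x) (hb : b ∈ powerSpan x) :
    a * b ∈ powerSpan x := by
  have hx : ∀ b ∈ powerSpan x, x * b ∈ powerSpan x := fun b hb => by
    induction hb using Submodule.span_induction with
    | mem b hb => obtain ⟨n, rfl⟩ := hb; exact power_succ x n ▸ power_mem x (n + 1)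
    | zero => rw [mul_zero]; exact zero_mem _
    | add a b _ _ ha hb => rw [mul_add]; exact add_mem ha hb
    | smul t a _ ha => rw [mul_smul_comm]; exact Submodule.smul_mem _ _ ha
  have hp : ∀ n, power x n * b ∈ powerSpan x := fun n => by
    induction n with
    | zero => rwa [power_zero, one_mul]
    | succ n ih => rw [power_succ, mul_assoc_of_mem (self_mem_powerSpan x) hb]; exact hx _ ih
  induction ha using Submodule.span_induction with
  | mem a ha => obtain ⟨n, rfl⟩ := ha; exact hp n
  | zero => rw [zero_mul]; exact zero_mem _
  | add a c _ _ ha hc => rw [add_mul]; exact add_mem ha hc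
  | smul t a _ ha => rw [smul_mul_assoc]; exact Submodule.smul_mem _ _ ha

theorem powerSpan_le {x y : J} (h : y ∈ powerSpan x) : powerSpan y ≤ powerSpan x := by
  refine Submodule.span_le.2 ?_
  rintro _ ⟨n, rfl⟩
  change power y n ∈ powerSpan x
  induction n with
  | zero => exact one_mem_powerSpan x
  | succ n ih => rw [power_succ]; exact mul_mem_powerSpan h ih

/-! ### Invertible elements -/

theorem quadRep_of_mem {x a b : J} (ha : a ∈ powerSpan x) (hb : b ∈ powerSpan x) :
    quadRep a b = a * (a * b) := by
  rw [quadRep_apply, mul_assoc_of_mem ha hb]; module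

/-- By the fundamental formula P(x)P(u)P(x) = P(P(x)u) = P(e) = 1. -/
theorem quadRep_injective_of_apply_eq_one {x u : J} (h : quadRep x u = 1) :
    Function.Injective (quadRep x) := by
  intro y z hyz
  have key : ∀ w, quadRep x (quadRep u (quadRep x w)) = w := fun w => by
    rw [← quadRep_quadRep, h, quadRep_one]
  rw [← key y, hyz, key]

/-- P(x) preserves the finite-dimensional space ℝ[x], so injectivity gives z ∈ ℝ[x] with x(xz) = e.
-/
theorem isInvertible_of_quadRep_injective {x : J} (h : Function.Injective (quadRep x)) :
    IsInvertible x := by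
  have hm : ∀ z ∈ powerSpan x, quadRep x z ∈ powerSpan x := fun z hz => by
    rw [quadRep_of_mem (self_mem_powerSpan x) hz]
    exact mul_mem_powerSpan (self_mem_powerSpan x) (mul_mem_powerSpan (self_mem_powerSpan x) hz)
  have hs : Function.Surjective ((quadRep x).restrict hm) :=
    LinearMap.injective_iff_surjective.1 fun a b hab =>
      Subtype.ext (h (congrArg Subtype.val hab))
  obtain ⟨⟨z, hz⟩, hz'⟩ := hs ⟨1, one_mem_powerSpan x⟩
  have hz'' : quadRep x z = 1 := congrArg Subtype.val hz'
  rw [quadRep_of_mem (self_mem_powerSpan x) hz] at hz''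
  exact ⟨x * z, mul_mem_powerSpan (self_mem_powerSpan x) hz, hz''⟩

theorem jinv_mem {x : J} (h : IsInvertible x) : jinv x ∈ powerSpan x := by
  rw [jinv, dif_pos h]; exact h.choose_spec.1

theorem mul_jinv {x : J} (h : IsInvertible x) : x * jinv x = 1 := by
  rw [jinv, dif_pos h]; exact h.choose_spec.2

theorem quadRep_jinv {x : J} (h : IsInvertible x) : quadRep x (jinv x) = x := by
  rw [quadRep_of_mem (self_mem_powerSpan x) (jinv_mem h), mul_jinv h, mul_one]

theorem quadRep_jinv_sq {x : J} (h : IsInvertible x) : quadRep x (jinv x * jinv x) = 1 := by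
  have hx := self_mem_powerSpan x
  have hi := jinv_mem h
  rw [quadRep_of_mem hx (mul_mem_powerSpan hi hi), ← mul_assoc_of_mem hx hi, mul_jinv h, one_mul,
    mul_jinv h]

theorem IsInvertible.quadRep_injective {x : J} (h : IsInvertible x) :
    Function.Injective (quadRep x) :=
  quadRep_injective_of_apply_eq_one (quadRep_jinv_sq h)

theorem isInvertible_iff {x : J} : IsInvertible x ↔ Function.Injective (quadRep x) :=
  ⟨fun h => h.quadRep_injective, isInvertible_of_quadRep_injective⟩

theorem isInvertible_one : IsInvertible (1 : J) :=
  ⟨1, one_mem_powerSpan 1, mul_one 1⟩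

/-- The segment from `e` to the square of an invertible element consists of invertible
elements. -/
theorem isInvertible_segment {y : J} (hy : IsInvertible y) {t : ℝ} (h0 : 0 ≤ t) (h1 : t ≤ 1) :
    IsInvertible ((1 - t) • (1 : J) + t • (y * y)) := by
  set x := (1 - t) • (1 : J) + t • (y * y) with hx
  have hyy := self_mem_powerSpan y
  have hxy : x ∈ powerSpan y := add_mem (Submodule.smul_mem _ _ (one_mem_powerSpan y))
    (Submodule.smul_mem _ _ (mul_mem_powerSpan hyy hyy))
  have hle := powerSpan_le hxy
  have hm : ∀ z ∈ powerSpan x, mulOp x z ∈ powerSpan x := fun z hz =>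
    mul_mem_powerSpan (self_mem_powerSpan x) hz
  have hinj : Function.Injective ((mulOp x).restrict hm) := by
    refine (injective_iff_map_eq_zero _).2 fun z hz => ?_
    obtain ⟨z, hzx⟩ := z
    have hz' : x * z = 0 := congrArg Subtype.val hz
    -- This is ⟨xz, z⟩ = 0, using y²z = y(yz) and the symmetry of L(y). For t > 0 it forces yz = 0,
    -- and the inverse of y in ℝ[y] then gives z = 0.
    have h2 : (1 - t) * inner ℝ z z + t * inner ℝ (y * z) (y * z) = 0 := by
      have h3 : inner ℝ (x * z) z = (0 : ℝ) := by rw [hz', inner_zero_left]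
      rw [hx, add_mul, smul_mul_assoc, one_mul, smul_mul_assoc, mul_assoc_of_mem hyy (hle hzx),
        inner_add_left, inner_smul_left, inner_smul_left, inner_mul'] at h3
      simpa using h3
    have hz0 : 0 ≤ (inner ℝ z z : ℝ) := real_inner_self_nonneg
    have hyz0 : 0 ≤ (inner ℝ (y * z) (y * z) : ℝ) := real_inner_self_nonneg
    refine Subtype.ext ?_
    change z = 0
    rcases h0.eq_or_lt with rfl | h0
    · have : inner ℝ z z = (0 : ℝ) := by linarith
      exact inner_self_eq_zero.1 this
    · have h4 : inner ℝ (y * z) (y * z) = (0 : ℝ) := by nlinarith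
      have h5 := inner_self_eq_zero.1 h4
      have h6 := mul_assoc_of_mem (jinv_mem hy) (hle hzx) (b := y)
      rwa [h5, mul_zero, mul_comm (jinv y), mul_jinv hy, one_mul] at h6
  obtain ⟨⟨z, hz⟩, hz'⟩ := LinearMap.injective_iff_surjective.1 hinj ⟨1, one_mem_powerSpan x⟩
  exact ⟨z, hz, congrArg Subtype.val hz'⟩

theorem IsInvertible.mul_self {y : J} (hy : IsInvertible y) : IsInvertible (y * y) := by
  simpa using isInvertible_segment hy zero_le_one le_rfl

end Algebra

end EuclideanJordanAlgebra

namespace EuclideanJordanAlgebra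

/-! ### The differential of inversion and equations for Str(J). -/

section Analysis

variable {J : Type*} [NormedAddCommGroup J] [InnerProductSpace ℝ J] [EuclideanJordanAlgebra J]

scoped instance instCompleteSpace : CompleteSpace J := FiniteDimensional.complete ℝ J

/-- The multiplication of `J` as a continuous bilinear map. -/
noncomputable def mulCLM : J →L[ℝ] J →L[ℝ] J :=
  LinearMap.toContinuousLinearMap
    { toFun := fun x => LinearMap.toContinuousLinearMap (mulOp x)
      map_add' := fun x y => by rw [mulOp_add, map_add]
      map_smul' := fun t x => by rw [mulOp_smul, map_smul, RingHom.id_apply] }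

@[simp] theorem mulCLM_apply (x y : J) : mulCLM x y = x * y := rfl

/-- The quadratic representation with values in the continuous operators. -/
noncomputable def quadCLM (x : J) : J →L[ℝ] J :=
  (2 : ℝ) • (mulCLM x * mulCLM x) - mulCLM (mulCLM x x)

theorem quadCLM_apply (x y : J) : quadCLM x y = quadRep x y := rfl

theorem quadCLM_one : quadCLM (1 : J) = 1 := ContinuousLinearMap.ext quadRep_one

theorem quadCLM_quadCLM (x y : J) :
    quadCLM (quadCLM x y) = quadCLM x * quadCLM y * quadCLM x :=
  ContinuousLinearMap.ext (quadRep_quadRep x y)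

theorem contDiff_quadCLM : ContDiff ℝ 1 (quadCLM : J → J →L[ℝ] J) := by
  unfold quadCLM
  have h : ContDiff ℝ 1 (mulCLM : J → J →L[ℝ] J) :=
    ContinuousLinearMap.contDiff (𝕜 := ℝ) (E := J) (F := J →L[ℝ] J) mulCLM
  exact ((h.mul h).const_smul (2 : ℝ)).sub (h.comp (h.clm_apply contDiff_id))

theorem continuous_quadCLM : Continuous (quadCLM : J → J →L[ℝ] J) :=
  contDiff_quadCLM.continuous

theorem isUnit_iff_injective {A : J →L[ℝ] J} : IsUnit A ↔ Function.Injective A := by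
  rw [ContinuousLinearMap.isUnit_iff_bijective]
  exact ⟨fun h => h.1, fun h => ⟨h, (LinearMap.injective_iff_surjective (f := A.toLinearMap)).1 h⟩⟩

theorem isInvertible_iff_isUnit {x : J} : IsInvertible x ↔ IsUnit (quadCLM x) := by
  rw [isUnit_iff_injective, isInvertible_iff]; rfl

theorem isOpen_isInvertible : IsOpen {x : J | IsInvertible x} := by
  have h : {x : J | IsInvertible x} = quadCLM ⁻¹' {A | IsUnit A} :=
    Set.ext fun x => isInvertible_iff_isUnit
  rw [h]
  exact Units.isOpen.preimage continuous_quadCLM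

theorem jinv_eq {x : J} (h : IsInvertible x) : jinv x = Ring.inverse (quadCLM x) x := by
  have h1 := isInvertible_iff_isUnit.1 h
  have h2 := congrArg (fun A : J →L[ℝ] J => A (jinv x)) (Ring.inverse_mul_cancel _ h1)
  have h3 : Ring.inverse (quadCLM x) (quadRep x (jinv x)) = jinv x := h2
  rw [← h3, quadRep_jinv h]

theorem differentiableAt_jinv {x : J} (h : IsInvertible x) : DifferentiableAt ℝ jinv x := by
  have h1 := isInvertible_iff_isUnit.1 h
  have h2 : DifferentiableAt ℝ (fun y : J => Ring.inverse (quadCLM y) y) x := by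
    have h3 : DifferentiableAt ℝ (fun y : J => Ring.inverse (quadCLM y)) x :=
      (differentiableAt_inverse h1).comp x
        (contDiff_quadCLM.contDiffAt.differentiableAt (by simp))
    exact h3.clm_apply differentiableAt_id
  refine h2.congr_of_eventuallyEq ?_
  filter_upwards [isOpen_isInvertible.mem_nhds h] with y hy using jinv_eq hy

/-- The differential of the inversion at `x` is `-P(x)⁻¹`. -/
theorem quadRep_fderiv_jinv {x : J} (h : IsInvertible x) (u : J) :
    quadRep x (fderiv ℝ jinv x u) = -u := by
  have hline : HasDerivAt (fun t : ℝ => x + t • u) u 0 := by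
    simpa using ((hasDerivAt_id (0 : ℝ)).smul_const u).const_add x
  have hg : HasDerivAt (fun t : ℝ => jinv (x + t • u)) (fderiv ℝ jinv x u) 0 := by
    have h1 : HasFDerivAt jinv (fderiv ℝ jinv x) (x + (0 : ℝ) • u) := by
      rw [zero_smul, add_zero]; exact (differentiableAt_jinv h).hasFDerivAt
    exact h1.comp_hasDerivAt 0 hline
  have h0 : x + (0 : ℝ) • u = x := by rw [zero_smul, add_zero]
  let T : J →L[ℝ] J := LinearMap.toContinuousLinearMap
    { toFun := fun y => triple x y u
      map_add' := fun y z => triple_add_mid x y z u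
      map_smul' := fun t y => triple_smul_mid t x y u }
  have hT : ∀ y, T y = triple x y u := fun y => rfl
  have hsum : HasDerivAt (fun t : ℝ => quadCLM x (jinv (x + t • u))
      + (2 * t) • T (jinv (x + t • u)) + (t * t) • quadCLM u (jinv (x + t • u)))
      (quadCLM x (fderiv ℝ jinv x u) + (2 : ℝ) • T (jinv x)) 0 := by
    have h1 := (quadCLM x).hasFDerivAt.comp_hasDerivAt (0 : ℝ) hg
    have h2 := T.hasFDerivAt.comp_hasDerivAt (0 : ℝ) hg
    have h3 := (quadCLM u).hasFDerivAt.comp_hasDerivAt (0 : ℝ) hg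
    have h4 : HasDerivAt (fun t : ℝ => 2 * t) 2 0 := by
      simpa using (hasDerivAt_id (0 : ℝ)).const_mul 2
    have h5 : HasDerivAt (fun t : ℝ => t * t) 0 0 := by
      exact ((hasDerivAt_id (0 : ℝ)).mul (hasDerivAt_id (0 : ℝ))).congr_deriv (by simp)
    have h6 := (h1.add (h4.smul h2)).add (h5.smul h3)
    refine h6.congr_deriv ?_
    simp
  -- This is P(z)z⁻¹ = z along z = x + tu, with P(z) expanded in t. Comparing derivatives at 0 gives
  -- P(x)D + 2{x x⁻¹ u} = u, where D is the derivative of inversion in direction u and {x x⁻¹ u} =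
  -- u.
  have heq : (fun t : ℝ => x + t • u) =ᶠ[𝓝 0] fun t : ℝ => quadCLM x (jinv (x + t • u))
      + (2 * t) • T (jinv (x + t • u)) + (t * t) • quadCLM u (jinv (x + t • u)) := by
    have h1 : ∀ᶠ t : ℝ in 𝓝 0, IsInvertible (x + t • u) := by
      refine hline.continuousAt.eventually (isOpen_isInvertible.mem_nhds ?_)
      change IsInvertible (x + (0 : ℝ) • u)
      rwa [h0]
    filter_upwards [h1] with t ht
    have h2 := quadRep_jinv ht
    rw [quadRep_add_smul] at h2
    exact h2.symm
  have h7 := hline.unique (hsum.congr_of_eventuallyEq heq)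
  have h8 : triple x (jinv x) u = u := by
    rw [triple, mul_jinv h, mul_left_comm_of_mem (self_mem_powerSpan x) (jinv_mem h), one_mul]
    abel
  rw [hT, h8, quadCLM_apply] at h7
  linear_combination (norm := module) -h7

theorem GLin.val_inv_apply (l : GLin J) (x : J) : l.val (l⁻¹.val x) = x :=
  congrArg (fun f : J →L[ℝ] J => f x) l.mul_inv

theorem GLin.inv_val_apply (l : GLin J) (x : J) : l⁻¹.val (l.val x) = x :=
  congrArg (fun f : J →L[ℝ] J => f x) l.inv_mul

/-- `Str(J)` is the group of all `ℓ` with `P(ℓ x) = ℓ P(x) ℓ⁻¹ P(ℓ e)`. -/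
theorem mem_structureGroup_of_quadCLM {l : GLin J}
    (hl : ∀ x, quadCLM (l.val x) = l.val * quadCLM x * l⁻¹.val * quadCLM (l.val 1)) :
    l ∈ structureGroup J := by
  have h1 : IsUnit (quadCLM (l.val 1)) := by
    rw [isUnit_iff_injective]
    have h2 := hl (l⁻¹.val 1)
    rw [GLin.val_inv_apply, quadCLM_one] at h2
    intro y z hyz
    have h3 : ∀ w, w = (l.val * quadCLM (l⁻¹.val 1) * l⁻¹.val) (quadCLM (l.val 1) w) :=
      fun w => congrArg (fun f : J →L[ℝ] J => f w) h2
    rw [h3 y, hyz, ← h3]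
  obtain ⟨u, hu⟩ := h1
  have hinv : ∀ x : J, IsInvertible (l.val x) ↔ IsInvertible x := fun x => by
    rw [isInvertible_iff_isUnit, isInvertible_iff_isUnit, hl, ← hu, Units.isUnit_mul_units,
      Units.isUnit_mul_units, Units.isUnit_units_mul]
  -- The equation for P(ℓx) leaves no choice: h = P(ℓe)⁻¹ℓ.
  refine ⟨hinv, u⁻¹ * l, fun x hx => ?_⟩
  apply ((hinv x).2 hx).quadRep_injective
  rw [quadRep_jinv ((hinv x).2 hx), ← quadCLM_apply, hl, ← hu]
  change l.val x = l.val (quadRep x (l⁻¹.val (u.val (u⁻¹.val (l.val (jinv x))))))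
  rw [GLin.val_inv_apply, GLin.inv_val_apply, quadRep_jinv hx]

/-- Differentiating (ℓy)⁻¹ = h y⁻¹ gives P(ℓy)⁻¹ℓ = hP(y)⁻¹, that is P(ℓy)h = ℓP(y). The case y = e
identifies h, which is then eliminated. -/
theorem quadCLM_of_mem_of_isInvertible {l : GLin J} (hl : l ∈ structureGroup J) {x : J}
    (hx : IsInvertible x) :
    quadCLM (l.val x) = l.val * quadCLM x * l⁻¹.val * quadCLM (l.val 1) := by
  obtain ⟨hinv, h, hh⟩ := hl
  have key : ∀ y : J, IsInvertible y → quadCLM (l.val y) * h.val = l.val * quadCLM y := by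
    intro y hy
    have hly := (hinv y).2 hy
    have h1 : HasFDerivAt (fun z => jinv (l.val z)) (fderiv ℝ jinv (l.val y) ∘L l.val) y :=
      (differentiableAt_jinv hly).hasFDerivAt.comp y l.val.hasFDerivAt
    have h2 : HasFDerivAt (fun z => h.val (jinv z)) (h.val ∘L fderiv ℝ jinv y) y :=
      h.val.hasFDerivAt.comp y (differentiableAt_jinv hy).hasFDerivAt
    have h3 : (fun z => jinv (l.val z)) =ᶠ[𝓝 y] fun z => h.val (jinv z) := by
      filter_upwards [isOpen_isInvertible.mem_nhds hy] with z hz using hh z hz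
    have h4 := h1.unique (h2.congr_of_eventuallyEq h3)
    have h5 : ∀ w, fderiv ℝ jinv y (quadRep y w) = -w := fun w => by
      apply hy.quadRep_injective
      rw [quadRep_fderiv_jinv hy, map_neg]
    ext w
    have h6 : fderiv ℝ jinv (l.val y) (l.val (quadRep y w))
        = h.val (fderiv ℝ jinv y (quadRep y w)) :=
      congrArg (fun f : J →L[ℝ] J => f (quadRep y w)) h4
    have h7 := congrArg (quadRep (l.val y)) h6
    rw [quadRep_fderiv_jinv hly, h5, map_neg, map_neg] at h7
    exact (neg_injective h7).symm
  have h1 := key 1 isInvertible_one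
  rw [quadCLM_one, mul_one] at h1
  have h2 := key x hx
  have hu := isInvertible_iff_isUnit.1 ((hinv 1).2 isInvertible_one)
  have h3 : h.val * l⁻¹.val * quadCLM (l.val 1) = 1 := by
    refine hu.mul_left_cancel ?_
    rw [← mul_assoc, ← mul_assoc, h1, Units.mul_inv, one_mul, mul_one]
  rw [← h2, mul_assoc, mul_assoc, ← mul_assoc h.val, h3, mul_one]

/-- Both sides are quadratic in x. For small s ≠ 0 the points e and e ± sx are invertible, and the
second difference of the identity at these points isolates the value at x. -/
theorem quadCLM_of_mem {l : GLin J} (hl : l ∈ structureGroup J) (x : J) :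
    quadCLM (l.val x) = l.val * quadCLM x * l⁻¹.val * quadCLM (l.val 1) := by
  have hpos : ∀ᶠ s : ℝ in 𝓝 0, IsInvertible ((1 : J) + s • x) := by
    have hc : ContinuousAt (fun s : ℝ => (1 : J) + s • x) 0 := by fun_prop
    refine hc.eventually (isOpen_isInvertible.mem_nhds ?_)
    change IsInvertible ((1 : J) + (0 : ℝ) • x)
    rw [zero_smul, add_zero]; exact isInvertible_one
  have hneg : ∀ᶠ s : ℝ in 𝓝 0, IsInvertible ((1 : J) + (-s) • x) := by
    have hc : ContinuousAt (fun s : ℝ => -s) 0 := by fun_prop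
    exact hc.tendsto.eventually (by simpa using hpos)
  obtain ⟨s, ⟨h1, h2⟩, hs⟩ := ((hpos.and hneg).filter_mono nhdsWithin_le_nhds).and
    (self_mem_nhdsWithin (s := {(0 : ℝ)}ᶜ)) |>.exists
  have hs0 : s ≠ 0 := hs
  ext y
  have e1 := congrArg (fun f : J →L[ℝ] J => f y) (quadCLM_of_mem_of_isInvertible hl h1)
  have e2 := congrArg (fun f : J →L[ℝ] J => f y) (quadCLM_of_mem_of_isInvertible hl h2)
  have e0 := congrArg (fun f : J →L[ℝ] J => f y)
    (quadCLM_of_mem_of_isInvertible hl isInvertible_one)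
  simp only [mul_apply_eq_comp,  quadCLM_apply, map_add, map_smul, quadRep_add_smul]
    at e0 e1 e2 ⊢
  have e3 : (s * s) • (quadRep (l.val x) y
      - l.val (quadRep x (l⁻¹.val (quadRep (l.val 1) y)))) = 0 := by
    linear_combination (norm := module) (1 / 2 : ℝ) • e1 + (1 / 2 : ℝ) • e2 - e0
  exact sub_eq_zero.1 ((smul_eq_zero.1 e3).resolve_left (mul_ne_zero hs0 hs0))

theorem mem_structureGroup_iff {l : GLin J} :
    l ∈ structureGroup J ↔
      ∀ x, quadCLM (l.val x) = l.val * quadCLM x * l⁻¹.val * quadCLM (l.val 1) :=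
  ⟨quadCLM_of_mem, mem_structureGroup_of_quadCLM⟩

theorem isClosed_structureGroup : IsClosed (structureGroup J : Set (GLin J)) := by
  have h : (structureGroup J : Set (GLin J)) = ⋂ x : J, {l : GLin J |
      quadCLM (l.val x) = l.val * quadCLM x * l⁻¹.val * quadCLM (l.val 1)} := by
    ext l
    simp only [SetLike.mem_coe, mem_structureGroup_iff, Set.mem_iInter, Set.mem_ofPred_eq]
  rw [h]
  refine isClosed_iInter fun x => ?_
  have h1 : Continuous fun l : GLin J => l.val := Units.continuous_val
  have h2 : Continuous fun l : GLin J => l⁻¹.val := Units.continuous_val.comp continuous_inv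
  have h3 : ∀ z : J, Continuous fun l : GLin J => quadCLM (l.val z) := fun z =>
    continuous_quadCLM.comp (h1.clm_apply continuous_const)
  exact isClosed_eq (h3 x) (((h1.mul continuous_const).mul h2).mul (h3 1))

theorem mem_structureGroup_of_eq_quadCLM {l : GLin J} {a : J} (hl : l.val = quadCLM a) :
    l ∈ structureGroup J := by
  refine mem_structureGroup_iff.2 fun x => ?_
  rw [hl, quadCLM_quadCLM, quadCLM_quadCLM, quadCLM_one, mul_one, ← hl]
  simp only [mul_assoc, Units.inv_mul_cancel_left]

theorem exists_unit_quadCLM {x : J} (hx : IsInvertible x) : ∃ g : GLin J, g.val = quadCLM x :=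
  isInvertible_iff_isUnit.1 hx

end Analysis

end EuclideanJordanAlgebra

namespace EuclideanJordanAlgebra

section Derivations

variable {J : Type*} [NormedAddCommGroup J] [InnerProductSpace ℝ J] [EuclideanJordanAlgebra J]

/-- The span of the commutators `[L(x), L(y)]`. -/
def innerDer (J : Type*) [NormedAddCommGroup J] [InnerProductSpace ℝ J]
    [EuclideanJordanAlgebra J] : Submodule ℝ (Module.End ℝ J) :=
  Submodule.span ℝ (Set.range fun p : J × J => mulOp p.1 * mulOp p.2 - mulOp p.2 * mulOp p.1)

theorem inner_innerDer {A : Module.End ℝ J} (hA : A ∈ innerDer J) (x y : J) :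
    inner ℝ (A x) y = -inner ℝ x (A y) := by
  induction hA using Submodule.span_induction with
  | mem A hA =>
    obtain ⟨p, rfl⟩ := hA
    simp only [LinearMap.sub_apply, Module.End.mul_apply, mulOp_apply, inner_sub_left,
      inner_sub_right, inner_mul']
    ring
  | zero => simp
  | add A B _ _ hA hB =>
    rw [LinearMap.add_apply, inner_add_left, hA, hB, LinearMap.add_apply, inner_add_right]; ring
  | smul t A _ hA =>
    rw [LinearMap.smul_apply, inner_smul_left, hA, LinearMap.smul_apply, inner_smul_right]; simp

/-- In an orthonormal basis Σ|Ab_i|² = s tr(A²). It is applied with s = 1 to symmetric and s = -1 to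
skew operators. -/
theorem eq_zero_of_trace_mul_self {A : Module.End ℝ J} (s : ℝ)
    (hA : ∀ x y : J, inner ℝ (A x) y = s * inner ℝ x (A y))
    (h : LinearMap.trace ℝ J (A * A) = 0) : A = 0 := by
  let b := stdOrthonormalBasis ℝ J
  rw [LinearMap.trace_eq_sum_inner _ b] at h
  have h1 : ∑ i, (inner ℝ (A (b i)) (A (b i)) : ℝ) = 0 := by
    rw [← mul_zero s, ← h, Finset.mul_sum]
    exact Finset.sum_congr rfl fun i _ => hA _ _
  rw [Finset.sum_eq_zero_iff_of_nonneg fun i _ => real_inner_self_nonneg] at h1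
  refine b.toBasis.ext fun i => ?_
  rw [OrthonormalBasis.coe_toBasis]
  exact inner_self_eq_zero.1 (h1 i (Finset.mem_univ i))

/-- Every derivation of a Euclidean Jordan algebra is inner. -/
theorem mem_innerDer_of_derivation {D : Module.End ℝ J}
    (hD : ∀ x y, D (x * y) = D x * y + x * D y) : D ∈ innerDer J := by
  let B : LinearMap.BilinForm ℝ (Module.End ℝ J) :=
    (LinearMap.mul ℝ (Module.End ℝ J)).compr₂ (LinearMap.trace ℝ J)
  have hB : ∀ A C, B A C = LinearMap.trace ℝ J (A * C) := fun _ _ => rfl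
  have hsymm : B.IsRefl := fun A C h => by rw [hB, LinearMap.trace_mul_comm, ← hB, h]
  -- Inner derivations are skew for the inner product, so the trace form is definite on them and D
  -- splits into an inner part and a part orthogonal to all inner derivations.
  have hnd : (B.restrict (innerDer J)).Nondegenerate := by
    have hl : ∀ A : innerDer J, (∀ C, B.restrict (innerDer J) A C = 0) → A = 0 := fun A hA =>
      Subtype.ext (eq_zero_of_trace_mul_self (-1)
        (fun x y => by rw [inner_innerDer A.2]; ring) (hA A))
    refine ⟨hl, fun A hA => hl A fun C => ?_⟩
    exact hsymm _ _ (hA C)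
  have hc := LinearMap.BilinForm.isCompl_orthogonal_of_restrict_nondegenerate hsymm hnd
  have hsup : D ∈ innerDer J ⊔ B.orthogonal (innerDer J) := hc.sup_eq_top ▸ Submodule.mem_top
  obtain ⟨D₀, hD₀, D₁, hD₁, hsum⟩ := Submodule.mem_sup.1 hsup
  have hder : ∀ A ∈ innerDer J, ∀ x y, A (x * y) = A x * y + x * A y := fun A hA => by
    induction hA using Submodule.span_induction with
    | mem A hA =>
      obtain ⟨p, rfl⟩ := hA
      exact fun x y => commutator_mul p.1 p.2 x y
    | zero => simp
    | add A B _ _ hA hB =>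
      intro x y
      simp only [LinearMap.add_apply, hA, hB, add_mul, mul_add]; abel
    | smul t A _ hA =>
      intro x y
      simp only [LinearMap.smul_apply, hA, smul_add, smul_mul_assoc, mul_smul_comm]
  have hD₁' : ∀ x y, D₁ (x * y) = D₁ x * y + x * D₁ y := fun x y => by
    have e : D₁ = D - D₀ := by rw [← hsum]; abel
    simp only [e, LinearMap.sub_apply, hD, hder D₀ hD₀, sub_mul, mul_sub]; abel
  have hcomm : ∀ x, D₁ * mulOp x = mulOp (D₁ x) + mulOp x * D₁ := fun x =>
    LinearMap.ext fun y => hD₁' x y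
  have hzero : D₁ = 0 := by
    refine LinearMap.ext fun x => ?_
    have h1 : LinearMap.trace ℝ J
        ((mulOp x * mulOp (D₁ x) - mulOp (D₁ x) * mulOp x) * D₁) = 0 :=
      hD₁ _ (Submodule.subset_span ⟨(x, D₁ x), rfl⟩)
    -- As L(D₁x) = [D₁, L(x)], cyclicity turns this trace into tr([L(x), L(D₁x)]D₁), which vanishes
    -- by orthogonality.
    have h2 : LinearMap.trace ℝ J (mulOp (D₁ x) * mulOp (D₁ x)) = 0 := by
      have e : mulOp (D₁ x) = D₁ * mulOp x - mulOp x * D₁ := by rw [hcomm]; abel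
      have h3 : LinearMap.trace ℝ J (mulOp (D₁ x) * mulOp (D₁ x))
          = LinearMap.trace ℝ J ((D₁ * mulOp x - mulOp x * D₁) * mulOp (D₁ x)) := by rw [← e]
      rw [h3, ← h1, sub_mul, sub_mul, map_sub, map_sub, mul_assoc,
        LinearMap.trace_mul_comm ℝ D₁, mul_assoc (mulOp x) D₁,
        LinearMap.trace_mul_comm ℝ (mulOp x) (D₁ * _), mul_assoc D₁,
        LinearMap.trace_mul_comm ℝ D₁]
    have h4 := eq_zero_of_trace_mul_self 1
      (fun y z => by rw [mulOp_apply, inner_mul', one_mul, mulOp_apply]) h2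
    have h5 := LinearMap.congr_fun h4 1
    rwa [mulOp_apply, mul_one] at h5
  rw [← hsum, hzero, add_zero]
  exact hD₀

end Derivations

end EuclideanJordanAlgebra

/-! ### Tangent spaces of subgroups of the unit group of a normed algebra. -/

section TangentSpace

variable {R : Type*} [NormedRing R] [NormedAlgebra ℝ R]

/-- The space of the tangent vectors at `1` of the strictly differentiable curves in `G`. -/
def Subgroup.tangentSpace (G : Subgroup Rˣ) : Submodule ℝ R where
  carrier := {A | ∃ γ : ℝ → R, HasStrictDerivAt γ A 0 ∧ γ 0 = 1 ∧
    ∀ᶠ t in 𝓝 0, ∃ g ∈ G, g.val = γ t}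
  zero_mem' := ⟨fun _ => 1, hasStrictDerivAt_const _ _, rfl,
    Eventually.of_forall fun _ => ⟨1, one_mem _, rfl⟩⟩
  add_mem' := by
    rintro A B ⟨γ, hγ, h1, hG⟩ ⟨δ, hδ, h2, hH⟩
    refine ⟨fun t => γ t * δ t, ?_, by simp [h1, h2], ?_⟩
    · have h := hγ.mul hδ
      rw [h1, h2, mul_one, one_mul] at h
      exact h
    · filter_upwards [hG, hH] with t ⟨g, hg, hgt⟩ ⟨k, hk, hkt⟩
      exact ⟨g * k, mul_mem hg hk, by rw [Units.val_mul, hgt, hkt]⟩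
  smul_mem' := by
    rintro c A ⟨γ, hγ, h1, hG⟩
    have hc : HasStrictDerivAt (fun t : ℝ => c * t) c 0 := by
      simpa using (hasStrictDerivAt_id (0 : ℝ)).const_mul c
    refine ⟨fun t => γ (c * t), ?_, by simp [h1], ?_⟩
    · have h := HasStrictDerivAt.scomp (g₁ := γ) (0 : ℝ) (by simpa using hγ) hc
      exact h
    · have h : Tendsto (fun t : ℝ => c * t) (𝓝 0) (𝓝 0) := by
        simpa using hc.hasDerivAt.continuousAt.tendsto
      exact h.eventually hG

theorem Subgroup.conj_mem_tangentSpace {G : Subgroup Rˣ} {g : Rˣ} (hg : g ∈ G) {A : R}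
    (hA : A ∈ G.tangentSpace) : g.val * A * g⁻¹.val ∈ G.tangentSpace := by
  obtain ⟨γ, hγ, h1, hG⟩ := hA
  refine ⟨fun t => g.val * γ t * g⁻¹.val, (hγ.const_mul g.val).mul_const g⁻¹.val, ?_, ?_⟩
  · simp [h1]
  · filter_upwards [hG] with t ⟨k, hk, hkt⟩
    exact ⟨g * k * g⁻¹, mul_mem (mul_mem hg hk) (inv_mem hg), by simp [hkt]⟩

theorem Submodule.deriv_mem {V : Type*} [NormedAddCommGroup V] [NormedSpace ℝ V]
    {W : Submodule ℝ V} (hW : IsClosed (W : Set V)) {f : ℝ → V} {f' : V} {x : ℝ}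
    (hf : HasDerivAt f f' x) (h : ∀ᶠ t in 𝓝 x, f t ∈ W) : f' ∈ W := by
  have hx : f x ∈ W := h.self_of_nhds
  refine hW.mem_of_tendsto (hasDerivAt_iff_tendsto_slope.1 hf) ?_
  filter_upwards [h.filter_mono nhdsWithin_le_nhds] with t ht
  exact W.smul_mem _ (W.sub_mem ht hx)

variable [FiniteDimensional ℝ R]

/-- The commutator is the derivative at 0 of γ(t)Bγ(t)⁻¹, a curve in the tangent space, which is
closed because it is finite-dimensional. -/
theorem Subgroup.commutator_mem_tangentSpace {G : Subgroup Rˣ} {A B : R}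
    (hA : A ∈ G.tangentSpace) (hB : B ∈ G.tangentSpace) : A * B - B * A ∈ G.tangentSpace := by
  have := FiniteDimensional.complete ℝ R
  obtain ⟨γ, hγ, h1, hG⟩ := hA
  have hinv : HasDerivAt (fun t => Ring.inverse (γ t)) (-A) 0 := by
    have h2 : HasFDerivAt Ring.inverse (-ContinuousLinearMap.mulLeftRight ℝ R ↑(1 : Rˣ)⁻¹
        ↑(1 : Rˣ)⁻¹) (γ 0) := by
      rw [h1]; exact hasFDerivAt_ringInverse (𝕜 := ℝ) (1 : Rˣ)
    exact (h2.comp_hasDerivAt 0 hγ.hasDerivAt).congr_deriv (by simp)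
  have h4 := (hγ.hasDerivAt.mul_const B).mul hinv
  rw [h1, Ring.inverse_one, mul_one, one_mul, mul_neg, ← sub_eq_add_neg] at h4
  refine Submodule.deriv_mem (Submodule.closed_of_finiteDimensional _) h4 ?_
  filter_upwards [hG] with t ⟨g, hg, hgt⟩
  have h5 := G.conj_mem_tangentSpace hg hB
  rw [← Ring.inverse_unit, hgt] at h5
  exact h5

/-- A linear map into the tangent space of `G` is the strict derivative at `0` of a map into
`G`. -/
theorem Subgroup.exists_hasStrictFDerivAt {G : Subgroup Rˣ} (B : R →L[ℝ] R)
    (hB : ∀ u, B u ∈ G.tangentSpace) :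
    ∃ φ : R → R, HasStrictFDerivAt φ B 0 ∧ φ 0 = 1 ∧ ∀ᶠ u in 𝓝 0, ∃ g ∈ G, g.val = φ u := by
  let b := Module.finBasis ℝ R
  let c : Fin (Module.finrank ℝ R) → R →L[ℝ] ℝ := fun i =>
    LinearMap.toContinuousLinearMap (b.coord i)
  -- Each rank-one summand is realized by a curve in G composed with a coordinate; multiplying such
  -- maps adds their derivatives.
  have hsum : B = ∑ i, (c i).smulRight (B (b i)) := by
    ext u
    rw [_root_.sum_apply]
    conv_lhs => rw [← b.sum_repr u, map_sum]
    refine Finset.sum_congr rfl fun i _ => ?_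
    rw [map_smul]; rfl
  rw [hsum]
  refine Finset.sum_induction (fun i => (c i).smulRight (B (b i)))
    (fun B : R →L[ℝ] R => ∃ φ : R → R, HasStrictFDerivAt φ B 0 ∧ φ 0 = 1 ∧
      ∀ᶠ u in 𝓝 0, ∃ g ∈ G, g.val = φ u) ?_ ?_ ?_
  · rintro A B ⟨φ, hφ, h1, hG⟩ ⟨ψ, hψ, h2, hH⟩
    refine ⟨fun u => φ u * ψ u, ?_, by simp [h1, h2], ?_⟩
    · refine (hφ.mul' hψ).congr_fderiv ?_
      rw [h1, h2]
      ext u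
      simp [add_comm]
    · filter_upwards [hG, hH] with t ⟨g, hg, hgt⟩ ⟨k, hk, hkt⟩
      exact ⟨g * k, mul_mem hg hk, by rw [Units.val_mul, hgt, hkt]⟩
  · exact ⟨fun _ => 1, hasStrictFDerivAt_const _ _, rfl,
      Eventually.of_forall fun _ => ⟨1, one_mem _, rfl⟩⟩
  · intro i _
    obtain ⟨γ, hγ, h1, hG⟩ := hB (b i)
    have h0 : c i 0 = 0 := map_zero _
    refine ⟨fun u => γ (c i u), ?_, by simp [h1], ?_⟩
    · have h3 : HasStrictFDerivAt γ (ContinuousLinearMap.toSpanSingleton ℝ (B (b i))) (c i 0) := by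
        rw [h0]; exact hγ.hasStrictFDerivAt
      refine (h3.comp 0 (c i).hasStrictFDerivAt).congr_fderiv ?_
      ext u
      simp
    · have h : Tendsto (c i) (𝓝 0) (𝓝 0) := by
        simpa using (c i).continuous.tendsto 0
      exact h.eventually hG

/-- If `F` is constant on `H` and the kernel of its derivative at `1` is contained in the tangent
space of `G ≤ H`, then `G` contains a neighbourhood of `1` in `H`. -/
theorem Subgroup.eventually_mem_of_ker_le {G H : Subgroup Rˣ} (hGH : G ≤ H)
    {Z : Type*} [NormedAddCommGroup Z] [NormedSpace ℝ Z] {F : R → Z} {F' : R →L[ℝ] Z}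
    (hF : HasFDerivAt F F' 1) (hconst : ∀ h ∈ H, F h.val = F 1)
    (hker : ∀ w, F' w = 0 → w ∈ G.tangentSpace) :
    ∀ᶠ h in 𝓝 (1 : Rˣ), h ∈ H → h ∈ G := by
  have := FiniteDimensional.complete ℝ R
  obtain ⟨p, hp⟩ := Submodule.exists_isCompl G.tangentSpace
  let π₀ : R →ₗ[ℝ] R := G.tangentSpace.subtype ∘ₗ G.tangentSpace.projectionOnto p hp
  let π : R →L[ℝ] R := LinearMap.toContinuousLinearMap π₀
  have hπ : ∀ u, π u ∈ G.tangentSpace := fun u => (G.tangentSpace.projectionOnto p hp u).2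
  have hπ' : ∀ u ∈ G.tangentSpace, π u = u := fun u hu =>
    congrArg Subtype.val (Submodule.projectionOnto_apply_left hp ⟨u, hu⟩)
  obtain ⟨φ, hφ, h1, hG⟩ := G.exists_hasStrictFDerivAt π hπ
  -- The map has derivative π + (1 - π) = 1, so it is open at 0: every element near 1 factors as g(1
  -- + w) with g ∈ G and w in the complement ker π.
  have hΨ : HasStrictFDerivAt (fun u => φ u * (1 + (u - π u))) (ContinuousLinearMap.id ℝ R) 0 := by
    have h2 : HasStrictFDerivAt (fun u : R => 1 + (u - π u)) (ContinuousLinearMap.id ℝ R - π) 0 :=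
      ((hasStrictFDerivAt_id 0).sub π.hasStrictFDerivAt).const_add 1
    refine (hφ.mul' h2).congr_fderiv ?_
    rw [h1]
    ext u
    simp
  have hmap := hΨ.map_nhds_eq_of_surj LinearMap.range_id
  have hK : HasFDerivAt (fun w => (π w, F (1 + w))) (π.prod F') 0 := by
    have h3 : HasFDerivAt F F' (1 + (0 : R)) := by rwa [add_zero]
    have h4 : HasFDerivAt (fun w : R => 1 + w) (ContinuousLinearMap.id ℝ R) 0 :=
      (hasFDerivAt_id 0).const_add 1
    exact π.hasFDerivAt.prodMk (h3.comp 0 h4)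
  -- The kernel of F' lies in the tangent space, where π is the identity. Hence near 0 the
  -- conditions πw = 0 and F(1 + w) = F(1) force w = 0.
  have hinj : LinearMap.ker (π.prod F').toLinearMap = ⊥ := by
    refine LinearMap.ker_eq_bot'.2 fun w hw => ?_
    have h5 : π w = 0 := congrArg Prod.fst hw
    have h6 : F' w = 0 := congrArg Prod.snd hw
    rw [← hπ' w (hker w h6), h5]
  obtain ⟨C, _, hC⟩ := LinearMap.exists_antilipschitzWith _ hinj
  have hne : ∀ᶠ w in 𝓝 (0 : R), (π w, F (1 + w)) = (0, F 1) → w = 0 := by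
    have h7 := hK.eventually_ne (c := ((0 : R), F 1)) ⟨C, hC⟩
    rw [eventually_nhdsWithin_iff] at h7
    filter_upwards [h7] with w hw h8
    by_contra h9
    exact hw h9 h8
  have hcont : Tendsto (fun u : R => u - π u) (𝓝 0) (𝓝 0) := by
    have h8 : Continuous fun u : R => u - π u := by fun_prop
    simpa using h8.tendsto 0
  have hgood : ∀ᶠ y in 𝓝 (1 : R), ∃ u, (∃ g ∈ G, g.val = φ u) ∧
      ((π (u - π u), F (1 + (u - π u))) = (0, F 1) → u - π u = 0) ∧
      φ u * (1 + (u - π u)) = y := by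
    have h9 : φ 0 * (1 + ((0 : R) - π 0)) = 1 := by simp [h1]
    rw [h9] at hmap
    rw [← hmap, eventually_map]
    filter_upwards [hG, hcont.eventually hne] with u hu hu'
    exact ⟨u, hu, hu', rfl⟩
  have hval : Tendsto (fun h : Rˣ => h.val) (𝓝 1) (𝓝 1) :=
    Units.continuous_val.tendsto (1 : Rˣ)
  filter_upwards [hval.eventually hgood] with h ⟨u, ⟨g, hg, hgu⟩, hu, hhu⟩ hh
  have h10 : 1 + (u - π u) = (g⁻¹ * h).val := by
    rw [Units.val_mul, ← hhu, ← hgu, Units.inv_mul_cancel_left]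
  have h11 : u - π u = 0 := by
    refine hu (Prod.ext ?_ ?_)
    · change π (u - π u) = 0
      rw [map_sub, hπ' _ (hπ u), sub_self]
    · change F (1 + (u - π u)) = F 1
      rw [h10]
      exact hconst _ (mul_mem (inv_mem (hGH hg)) hh)
  have h12 : h = g := Units.ext (by rw [← hhu, h11, add_zero, mul_one, hgu])
  rwa [h12]

end TangentSpace

namespace EuclideanJordanAlgebra

/-! ### Neutral components of linear groups. -/

section NeutralComponent

variable {J : Type*} [NormedAddCommGroup J] [InnerProductSpace ℝ J]

theorem neutralComponent_le (H : Subgroup (GLin J)) : neutralComponent H ≤ H := by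
  rintro _ ⟨x, _, rfl⟩
  exact x.2

theorem isPreconnected_neutralComponent (H : Subgroup (GLin J)) :
    IsPreconnected (neutralComponent H : Set (GLin J)) := by
  have h : (neutralComponent H : Set (GLin J)) = Subtype.val '' connectedComponent (1 : H) := rfl
  rw [h]
  exact isPreconnected_connectedComponent.image _ continuous_subtype_val.continuousOn

theorem subset_neutralComponent {H : Subgroup (GLin J)} {S : Set (GLin J)}
    (hS : IsPreconnected S) (h1 : (1 : GLin J) ∈ S) (hSH : S ⊆ H) :
    S ⊆ neutralComponent H := by
  intro g hg
  have h2 : IsPreconnected (Subtype.val ⁻¹' S : Set H) := by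
    refine IsInducing.subtypeVal.isPreconnected_image.1 ?_
    refine (congrArg IsPreconnected (Set.Subset.antisymm ?_ ?_ : _ = S)).mpr hS
    · rintro _ ⟨x, hx, rfl⟩
      exact hx
    · exact fun x hx => ⟨⟨x, hSH hx⟩, hx, rfl⟩
  exact ⟨⟨g, hSH hg⟩, h2.subset_connectedComponent (x := (1 : H)) h1 hg, rfl⟩

/-- K ∩ H is a neighbourhood of 1 in H, hence an open and therefore closed subgroup of H. -/
theorem neutralComponent_le_of_eventually {H K : Subgroup (GLin J)}
    (h : ∀ᶠ g in 𝓝 (1 : GLin J), g ∈ H → g ∈ K) : neutralComponent H ≤ K := by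
  rintro _ ⟨x, hx, rfl⟩
  have h1 : (K.subgroupOf H : Set H) ∈ 𝓝 (1 : H) := by
    have h2 : Tendsto (Subtype.val : H → GLin J) (𝓝 1) (𝓝 1) := continuous_subtype_val.tendsto 1
    filter_upwards [h2.eventually h] with g hg using hg g.2
  have h3 : IsClopen (K.subgroupOf H : Set H) := by
    have h4 := Subgroup.isOpen_of_mem_nhds _ h1
    exact ⟨Subgroup.isClosed_of_isOpen _ h4, h4⟩
  exact h3.connectedComponent_subset (one_mem (K.subgroupOf H)) hx

theorem isClosed_neutralComponent {H : Subgroup (GLin J)} (hH : IsClosed (H : Set (GLin J))) :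
    IsClosed (neutralComponent H : Set (GLin J)) := by
  have h : (neutralComponent H : Set (GLin J)) = Subtype.val '' connectedComponent (1 : H) := rfl
  rw [h]
  exact hH.isClosedEmbedding_subtypeVal.isClosedMap _ isClosed_connectedComponent

end NeutralComponent

/-! ### Generation of L by the operators P(x), x ∈ Ω. -/

section Generation

variable {J : Type*} [NormedAddCommGroup J] [InnerProductSpace ℝ J] [EuclideanJordanAlgebra J]

/-- Squaring has the surjective strict derivative 2·id at e, and elements near e are invertible. -/
theorem cone_mem_nhds_one : cone J ∈ 𝓝 (1 : J) := by
  have h1 : HasStrictFDerivAt (fun x : J => mulCLM x x) ((2 : ℝ) • ContinuousLinearMap.id ℝ J) 1 := by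
    have h2 : HasStrictFDerivAt (mulCLM : J → J →L[ℝ] J) (mulCLM : J →L[ℝ] J →L[ℝ] J) 1 :=
      ContinuousLinearMap.hasStrictFDerivAt (mulCLM : J →L[ℝ] J →L[ℝ] J)
    refine (h2.clm_apply (hasStrictFDerivAt_id (1 : J))).congr_fderiv ?_
    ext u
    simp [two_smul]
  have h3 := h1.map_nhds_eq_of_surj (by
    refine LinearMap.range_eq_top.2 fun u => ⟨(1 / 2 : ℝ) • u, ?_⟩
    change (2 : ℝ) • (1 / 2 : ℝ) • u = u
    module)
  have h4 : mulCLM (1 : J) 1 = 1 := mul_one 1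
  rw [h4] at h3
  rw [← h3]
  change ∀ᶠ x in 𝓝 (1 : J), mulCLM x x ∈ cone J
  filter_upwards [isOpen_isInvertible.mem_nhds isInvertible_one] with x hx
  exact ⟨x, hx, rfl⟩

theorem isInvertible_of_mem_cone {x : J} (hx : x ∈ cone J) : IsInvertible x := by
  obtain ⟨y, hy, rfl⟩ := hx
  exact hy.mul_self

/-- The subgroup generated by the `P(x)`, `x ∈ Ω`. -/
def quadGroup (J : Type*) [NormedAddCommGroup J] [InnerProductSpace ℝ J]
    [EuclideanJordanAlgebra J] : Subgroup (GLin J) :=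
  Subgroup.closure {g : GLin J | ∃ x ∈ cone J, ∀ y : J, g.val y = quadRep x y}

theorem quadGroup_le : quadGroup J ≤ structureGroup J := by
  refine (Subgroup.closure_le _).2 ?_
  rintro g ⟨x, _, hg⟩
  exact mem_structureGroup_of_eq_quadCLM (ContinuousLinearMap.ext hg)

/-- P(e + tx) = 1 + 2tL(x) + t²P(x), and e + tx ∈ Ω for small t. -/
theorem mulCLM_mem_tangentSpace (x : J) : mulCLM x ∈ (quadGroup J).tangentSpace := by
  have h2 : (2 : ℝ) • mulCLM x ∈ (quadGroup J).tangentSpace := by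
    refine ⟨fun t => 1 + (2 * t) • mulCLM x + (t * t) • quadCLM x, ?_, by simp, ?_⟩
    · have h4 : HasStrictDerivAt (fun t : ℝ => 2 * t) 2 0 := by
        simpa using (hasStrictDerivAt_id (0 : ℝ)).const_mul 2
      have h5 : HasStrictDerivAt (fun t : ℝ => t * t) 0 0 :=
        ((hasStrictDerivAt_id (0 : ℝ)).mul (hasStrictDerivAt_id (0 : ℝ))).congr_deriv (by simp)
      exact (((h4.smul_const (mulCLM x)).const_add 1).add
        (h5.smul_const (quadCLM x))).congr_deriv (by simp)
    · have hc : Tendsto (fun s : ℝ => (1 : J) + s • x) (𝓝 0) (𝓝 1) := by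
        have h : Continuous (fun s : ℝ => (1 : J) + s • x) := by fun_prop
        simpa using h.tendsto 0
      filter_upwards [hc.eventually cone_mem_nhds_one] with t ht
      obtain ⟨g, hg⟩ := exists_unit_quadCLM (isInvertible_of_mem_cone ht)
      refine ⟨g, Subgroup.subset_closure ⟨_, ht, fun y => by rw [hg]; rfl⟩, ?_⟩
      ext y
      rw [hg, quadCLM_apply, quadRep_add_smul, quadRep_one]
      have h3 : triple 1 y x = x * y := by
        rw [triple, one_mul, one_mul, one_mul, mul_comm y x]; abel
      rw [h3]
      rfl
  have h3 := (quadGroup J).tangentSpace.smul_mem (1 / 2 : ℝ) h2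
  rwa [smul_smul, one_div, inv_mul_cancel₀ two_ne_zero, one_smul] at h3

theorem mem_tangentSpace_of_derivation {v : J →L[ℝ] J}
    (hv : ∀ x y, v (x * y) = v x * y + x * v y) : v ∈ (quadGroup J).tangentSpace := by
  have h1 : v.toLinearMap ∈ innerDer J := mem_innerDer_of_derivation hv
  have h2 : innerDer J ≤ (quadGroup J).tangentSpace.comap
      (LinearMap.toContinuousLinearMap : (J →ₗ[ℝ] J) ≃ₗ[ℝ] (J →L[ℝ] J)).toLinearMap := by
    refine Submodule.span_le.2 ?_
    rintro _ ⟨p, rfl⟩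
    exact Subgroup.commutator_mem_tangentSpace (mulCLM_mem_tangentSpace p.1)
      (mulCLM_mem_tangentSpace p.2)
  exact h2 h1

/-- The defining equations of the structure group, evaluated at `e`. -/
noncomputable def structureEq (x y : J) (A : J →L[ℝ] J) : J :=
  A x * A y - A (triple x (Ring.inverse A (A 1 * A 1)) y)

/-- Evaluating the equation of Str(J) at e gives (ℓz)² = ℓP(z)ℓ⁻¹((ℓe)²); the claim is its
polarization at z = x + y. -/
theorem structureEq_eq_zero {l : GLin J} (hl : l ∈ structureGroup J) (x y : J) :
    structureEq x y l.val = 0 := by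
  have h : ∀ z, l.val z * l.val z = l.val (quadRep z (l⁻¹.val (l.val 1 * l.val 1))) := fun z => by
    have h1 := congrArg (fun f : J →L[ℝ] J => f 1) (quadCLM_of_mem hl z)
    simp only [mul_apply_eq_comp, quadCLM_apply, quadRep_apply_one] at h1
    exact h1
  rw [structureEq, Ring.inverse_unit]
  have h2 := h (x + (1 : ℝ) • y)
  rw [quadRep_add_smul, map_add, map_add, map_smul, map_smul, one_mul, one_smul, map_add, ← h,
    ← h, map_smul, add_mul, mul_add, mul_add, mul_comm (l.val y) (l.val x)] at h2
  linear_combination (norm := module) (1 / 2 : ℝ) • h2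

theorem hasFDerivAt_structureEq (x y : J) : ∃ F' : (J →L[ℝ] J) →L[ℝ] J,
    HasFDerivAt (structureEq x y) F' 1 ∧
      ∀ w, F' w = w x * y + x * w y - w (x * y) - triple x (w 1) y := by
  let T : J →L[ℝ] J := LinearMap.toContinuousLinearMap
    { toFun := fun z => triple x z y
      map_add' := fun z w => triple_add_mid x z w y
      map_smul' := fun t z => triple_smul_mid t x z y }
  have hT : ∀ z, T z = triple x z y := fun z => rfl
  have he : ∀ z : J, HasFDerivAt (fun A : J →L[ℝ] J => A z) (ContinuousLinearMap.apply ℝ J z) 1 :=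
    fun z => (ContinuousLinearMap.apply ℝ J z).hasFDerivAt
  have hm : ∀ z w : J, HasFDerivAt (fun A : J →L[ℝ] J => mulCLM (A z) (A w))
      ((mulCLM z).comp (ContinuousLinearMap.apply ℝ J w)
        + (mulCLM w).comp (ContinuousLinearMap.apply ℝ J z)) 1 := fun z w => by
    have h1 : HasFDerivAt (fun A : J →L[ℝ] J => mulCLM (A z))
        ((mulCLM : J →L[ℝ] J →L[ℝ] J).comp (ContinuousLinearMap.apply ℝ J z)) 1 :=
      (mulCLM : J →L[ℝ] J →L[ℝ] J).hasFDerivAt.comp 1 (he z)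
    refine (h1.clm_apply (he w)).congr_fderiv ?_
    ext A
    simp [mul_comm w]
  have hi : HasFDerivAt (Ring.inverse : (J →L[ℝ] J) → J →L[ℝ] J)
      (-ContinuousLinearMap.id ℝ (J →L[ℝ] J)) 1 := by
    refine (hasFDerivAt_ringInverse (𝕜 := ℝ) (1 : GLin J)).congr_fderiv ?_
    ext A
    simp
  have h1 := hi.clm_apply (hm 1 1)
  have h2 := T.hasFDerivAt.comp (1 : J →L[ℝ] J) h1
  have h3 := (hm x y).sub ((hasFDerivAt_id (1 : J →L[ℝ] J)).clm_apply h2)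
  refine ⟨_, h3, fun w => ?_⟩
  have h4 : triple x 1 y = x * y := by rw [triple, mul_one, one_mul, one_mul]; abel
  simp only [_root_.sub_apply, _root_.add_apply,
    ContinuousLinearMap.comp_apply, ContinuousLinearMap.apply_apply, mulCLM_apply,
    ContinuousLinearMap.flip_apply, _root_.neg_apply, ContinuousLinearMap.id_apply,
    Function.comp_apply, id, Ring.inverse_one, one_apply_eq_self, one_mul, mul_one, map_add,
    hT, h4, mul_comm y (w x), add_neg_cancel_right]
  abel

/-- The neutral component of the structure group is generated by the `P(x)`, `x ∈ Ω`. -/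
theorem groupL_le_quadGroup : groupL J ≤ quadGroup J := by
  let b := Module.finBasis ℝ J
  let n := Module.finrank ℝ J
  choose F' hF' hF'' using fun p : Fin n × Fin n => hasFDerivAt_structureEq (b p.1) (b p.2)
  have hF : HasFDerivAt (fun A (p : Fin n × Fin n) => structureEq (b p.1) (b p.2) A)
      (ContinuousLinearMap.pi F') 1 := hasFDerivAt_pi.2 hF'
  refine neutralComponent_le_of_eventually
    (Subgroup.eventually_mem_of_ker_le quadGroup_le hF ?_ ?_)
  · intro h hh
    funext p
    rw [structureEq_eq_zero hh]
    exact (structureEq_eq_zero (one_mem (structureGroup J)) _ _).symm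
  · intro w hw
    have h1 : ∀ x y, w x * y + x * w y - w (x * y) - triple x (w 1) y = 0 := by
      have h2 : ∀ i j, w (b i) * b j + b i * w (b j) - w (b i * b j)
          - triple (b i) (w 1) (b j) = 0 := fun i j => by
        rw [← hF'' (i, j)]; exact congrFun hw (i, j)
      let β : J →ₗ[ℝ] J →ₗ[ℝ] J := LinearMap.mk₂ ℝ
        (fun x y => w x * y + x * w y - w (x * y) - triple x (w 1) y)
        (fun x x' y => by simp only [map_add, add_mul, triple_add_left]; abel)
        (fun c x y => by
          simp only [map_smul, smul_mul_assoc, triple_smul_left]; module)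
        (fun x y y' => by simp only [map_add, mul_add, triple_add_right]; abel)
        (fun c x y => by
          simp only [map_smul, mul_smul_comm, triple_smul_right]; module)
      have h3 : β = 0 := b.ext fun i => b.ext fun j => h2 i j
      exact fun x y => congrArg (fun f : J →ₗ[ℝ] J →ₗ[ℝ] J => f x y) h3
    -- Expanding {x (we) y} in the linearized equation turns it into the Leibniz rule for w - L(we).
    have h4 : w - mulCLM (w 1) ∈ (quadGroup J).tangentSpace := by
      refine mem_tangentSpace_of_derivation fun x y => ?_
      have h5 := h1 x y
      rw [triple] at h5
      simp only [_root_.sub_apply, mulCLM_apply, sub_mul, mul_sub]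
      rw [mul_comm (w 1) x]
      linear_combination (norm := module) -h5
    have h6 := add_mem h4 (mulCLM_mem_tangentSpace (w 1))
    rwa [sub_add_cancel] at h6

end Generation

end EuclideanJordanAlgebra

theorem Submodule.exists_mem_map_eq {V : Type*} [AddCommGroup V] [Module ℝ V]
    [FiniteDimensional ℝ V] {W : Submodule ℝ V} {A : V →ₗ[ℝ] V} (hA : Function.Injective A)
    (hW : ∀ x ∈ W, A x ∈ W) {y : V} (hy : y ∈ W) : ∃ x ∈ W, A x = y := by
  have h : Function.Surjective (A.restrict hW) :=
    LinearMap.injective_iff_surjective.1 fun a b hab =>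
      Subtype.ext (hA (congrArg Subtype.val hab))
  obtain ⟨x, hx⟩ := h ⟨y, hy⟩
  exact ⟨x.1, x.2, congrArg Subtype.val hx⟩

namespace EuclideanJordanAlgebra

/-! ### The Peirce spaces J_j and their projections P(c_j). -/

namespace CSOI

variable {J : Type*} [NormedAddCommGroup J] [InnerProductSpace ℝ J] [EuclideanJordanAlgebra J]
  {k : ℕ} (c : CSOI J k)

theorem elem_mem (j : Fin k) : c.elem j ∈ c.component j := c.idem j

theorem mul_mem_component {j : Fin k} {x y : J} (hx : x ∈ c.component j)
    (hy : y ∈ c.component j) : x * y ∈ c.component j :=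
  ((⟨x, hx⟩ : c.component j) * ⟨y, hy⟩).2

theorem one_sub_elem_idem (j : Fin k) :
    (1 - c.elem j) * (1 - c.elem j) = 1 - c.elem j := by
  rw [mul_sub, sub_mul, sub_mul, c.idem, mul_one, one_mul, mul_one]; abel

/-- Here c_i lies in the 1-space of e - c_j, so L(c_i) commutes with L(e - c_j) and c_i x is fixed
by c_j. But L(x) commutes with L(c_j), so c_j(c_i x) = x(c_j c_i) = 0. -/
theorem elem_mul_eq_zero {i j : Fin k} (hij : i ≠ j) {x : J} (hx : x ∈ c.component j) :
    c.elem i * x = 0 := by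
  have hx' : c.elem j * x = x := hx
  have h1 : (1 - c.elem j) * c.elem i = c.elem i := by
    rw [sub_mul, one_mul, c.orth _ _ hij.symm, sub_zero]
  have h2 := mul_left_comm_of_idem (c.one_sub_elem_idem j) h1 x
  rw [sub_mul, one_mul, sub_mul, one_mul, hx', sub_self, mul_zero, sub_eq_zero] at h2
  have h3 := mul_left_comm_of_idem (c.idem j) hx' (c.elem i)
  rw [c.orth _ _ hij.symm, mul_zero, mul_comm x] at h3
  rw [h2, h3]

theorem mul_eq_zero_of_ne {i j : Fin k} (hij : i ≠ j) {x y : J} (hx : x ∈ c.component i)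
    (hy : y ∈ c.component j) : x * y = 0 := by
  have hy' : c.elem j * y = y := hy
  have h0 := c.elem_mul_eq_zero hij.symm hx
  have h1 : (1 - c.elem j) * x = x := by rw [sub_mul, one_mul, h0, sub_zero]
  have h2 := mul_left_comm_of_idem (c.one_sub_elem_idem j) h1 y
  rw [sub_mul, one_mul, sub_mul, one_mul, hy', sub_self, mul_zero, sub_eq_zero] at h2
  have h3 := mul_left_comm_of_idem (c.idem j) hy' x
  rw [h0, mul_zero, mul_comm y] at h3
  rw [h2, h3]

/-- With L = L(c_j), the relation 2L³ - 3L² + L = 0 gives L(2L² - L) = 2L² - L. -/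
theorem quadRep_elem_mem (j : Fin k) (x : J) : quadRep (c.elem j) x ∈ c.component j := by
  change c.elem j * quadRep (c.elem j) x = quadRep (c.elem j) x
  have h := LinearMap.congr_fun (mulOp_mul_mul_self (c.elem j) (c.elem j)) x
  simp only [c.idem, LinearMap.sub_apply, LinearMap.add_apply, Module.End.mul_apply, mulOp_apply,
    LinearMap.smul_apply] at h
  rw [quadRep_apply, c.idem, mul_sub, mul_smul_comm]
  linear_combination (norm := module) h

theorem quadRep_elem_of_mem {j : Fin k} {x : J} (hx : x ∈ c.component j) :
    quadRep (c.elem j) x = x := by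
  have hx' : c.elem j * x = x := hx
  rw [quadRep_apply, c.idem, hx', hx']; module

theorem quadRep_elem_of_mem_of_ne {i j : Fin k} (hij : i ≠ j) {x : J} (hx : x ∈ c.component j) :
    quadRep (c.elem i) x = 0 := by
  rw [quadRep_apply, c.idem, c.elem_mul_eq_zero hij hx, mul_zero]; module

theorem component_le (j : Fin k) : c.component j ≤ c.subalgebra := le_iSup c.component j

theorem sum_quadRep_elem {x : J} (hx : x ∈ c.subalgebra) :
    ∑ j, quadRep (c.elem j) x = x := by
  induction hx using Submodule.iSup_induction' with
  | mem j x hx =>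
    rw [Finset.sum_eq_single j (fun i _ hi => c.quadRep_elem_of_mem_of_ne hi hx) (by simp),
      c.quadRep_elem_of_mem hx]
  | zero => simp
  | add x y _ _ hx hy => simp only [map_add, Finset.sum_add_distrib, hx, hy]

theorem one_mem_subalgebra : (1 : J) ∈ c.subalgebra := by
  rw [← c.sum_eq_one]
  exact sum_mem fun j _ => c.component_le j (c.elem_mem j)

theorem mul_of_mem {w : J} (hw : w ∈ c.subalgebra) {j : Fin k} {x : J} (hx : x ∈ c.component j) :
    w * x = quadRep (c.elem j) w * x := by
  conv_lhs => rw [← c.sum_quadRep_elem hw, Finset.sum_mul]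
  exact Finset.sum_eq_single j
    (fun i _ hi => c.mul_eq_zero_of_ne hi (c.quadRep_elem_mem i w) hx) (by simp)

/-- Distinct components annihilate each other, so both w and w² act on J_j through the j-th
component of w alone. -/
theorem quadRep_of_mem_component {w : J} (hw : w ∈ c.subalgebra) {j : Fin k} {x : J}
    (hx : x ∈ c.component j) : quadRep w x = quadRep (quadRep (c.elem j) w) x := by
  set v := quadRep (c.elem j) w with hv
  have hvj : v ∈ c.component j := c.quadRep_elem_mem j w
  have h1 : w * w = ∑ i, quadRep (c.elem i) w * quadRep (c.elem i) w := by
    conv_lhs => rw [← c.sum_quadRep_elem hw, Finset.mul_sum]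
    rw [c.sum_quadRep_elem hw]
    exact Finset.sum_congr rfl fun i _ => c.mul_of_mem hw (c.quadRep_elem_mem i w)
  have h2 : (w * w) * x = (v * v) * x := by
    rw [h1, Finset.sum_mul]
    exact Finset.sum_eq_single j (fun i _ hi => c.mul_eq_zero_of_ne hi
      (c.mul_mem_component (c.quadRep_elem_mem i w) (c.quadRep_elem_mem i w)) hx) (by simp)
  rw [quadRep_apply, quadRep_apply, h2, c.mul_of_mem hw hx, ← hv,
    c.mul_of_mem hw (c.mul_mem_component hvj hx)]

theorem quadRep_mem_component {j : Fin k} {w x : J} (hw : w ∈ c.subalgebra)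
    (hx : x ∈ c.component j) : quadRep w x ∈ c.component j := by
  have hv := c.quadRep_elem_mem j w
  rw [c.quadRep_of_mem_component hw hx, quadRep_apply]
  exact sub_mem (Submodule.smul_mem _ _ (c.mul_mem_component hv (c.mul_mem_component hv hx)))
    (c.mul_mem_component (c.mul_mem_component hv hv) hx)

theorem quadRep_mem_subalgebra {w x : J} (hw : w ∈ c.subalgebra) (hx : x ∈ c.subalgebra) :
    quadRep w x ∈ c.subalgebra := by
  rw [← c.sum_quadRep_elem hx, map_sum]
  exact sum_mem fun j _ => c.component_le j
    (c.quadRep_mem_component hw (c.quadRep_elem_mem j x))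

theorem coe_quadRep {j : Fin k} (x y : c.component j) :
    ((quadRep x y : c.component j) : J) = quadRep (x : J) (y : J) := rfl

/-! ### The groups `Str(𝐜)` and `L(𝐜)` -/

theorem injective_val (l : GLin J) : Function.Injective l.val := fun x y h => by
  rw [← GLin.inv_val_apply l x, h, GLin.inv_val_apply]

theorem mem_structureGroup_iff {l : GLin J} : l ∈ c.structureGroup ↔
    l ∈ EuclideanJordanAlgebra.structureGroup J ∧ ∀ x ∈ c.subalgebra, l.val x ∈ c.subalgebra := by
  refine ⟨fun h => ⟨h.1, fun x hx => ?_⟩, fun h => ⟨h.1, ?_⟩⟩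
  · have h1 : l.val x ∈ (fun x => l.val x) '' (c.subalgebra : Set J) := ⟨x, hx, rfl⟩
    rw [h.2] at h1
    exact h1
  · refine Set.Subset.antisymm (Set.image_subset_iff.2 h.2) fun y hy => ?_
    obtain ⟨x, hx, hxy⟩ := Submodule.exists_mem_map_eq (A := l.val.toLinearMap)
      (injective_val l) h.2 hy
    exact ⟨x, hx, hxy⟩

theorem isClosed_structureGroup : IsClosed (c.structureGroup : Set (GLin J)) := by
  have h : (c.structureGroup : Set (GLin J)) =
      (EuclideanJordanAlgebra.structureGroup J : Set (GLin J)) ∩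
      ⋂ x ∈ c.subalgebra, {l : GLin J | l.val x ∈ c.subalgebra} := by
    ext l
    simp only [Set.mem_inter_iff, SetLike.mem_coe, c.mem_structureGroup_iff, Set.mem_iInter,
      Set.mem_ofPred_eq]
  rw [h]
  refine EuclideanJordanAlgebra.isClosed_structureGroup.inter
    (isClosed_iInter fun x => isClosed_iInter fun _ => ?_)
  exact (Submodule.closed_of_finiteDimensional c.subalgebra).preimage
    (Units.continuous_val.clm_apply continuous_const)

theorem groupL_le : c.groupL ≤ EuclideanJordanAlgebra.groupL J :=
  subset_neutralComponent (isPreconnected_neutralComponent _) (one_mem _)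
    fun _ hl => (neutralComponent_le _ hl).1

/-- The subgroup of `Str(𝐜)` of the maps that preserve every `J_j`. -/
def componentGroup : Subgroup (GLin J) where
  carrier := {l | l ∈ c.structureGroup ∧ ∀ j x, l.val x ∈ c.component j ↔ x ∈ c.component j}
  one_mem' := ⟨one_mem _, fun _ _ => Iff.rfl⟩
  mul_mem' := by
    rintro a b ⟨ha, ha'⟩ ⟨hb, hb'⟩
    exact ⟨mul_mem ha hb, fun j x => (ha' j (b.val x)).trans (hb' j x)⟩
  inv_mem' := by
    rintro a ⟨ha, ha'⟩
    refine ⟨inv_mem ha, fun j x => ?_⟩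
    rw [← ha' j (a⁻¹.val x), GLin.val_inv_apply]

/-- The operator r = ℓP(c_i)ℓ⁻¹ satisfies rP(ℓe) = P(ℓc_i) with ℓc_i, ℓe ∈ J(𝐜), so it preserves
each J_j. It fixes v = ℓx, hence every component of v. For j ≠ i the j-th component is also killed
by P(c_i), so the norm bound forces it to vanish. -/
theorem map_mem_component {l : GLin J} (hl : l ∈ c.structureGroup) {i : Fin k}
    (hi : ‖l.val * quadCLM (c.elem i) * l⁻¹.val - quadCLM (c.elem i)‖ < 1) {x : J}
    (hx : x ∈ c.component i) : l.val x ∈ c.component i := by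
  obtain ⟨hl, hsub⟩ := c.mem_structureGroup_iff.1 hl
  set r := l.val * quadCLM (c.elem i) * l⁻¹.val with hr
  have hrj : ∀ j, ∀ y ∈ c.component j, r y ∈ c.component j := fun j y hy => by
    have h1 : IsInvertible (l.val 1) := (hl.1 1).2 isInvertible_one
    obtain ⟨z, hz, hzy⟩ := Submodule.exists_mem_map_eq h1.quadRep_injective
      (fun z hz => c.quadRep_mem_component (hsub 1 c.one_mem_subalgebra) hz) hy
    have h2 := congrArg (fun f : J →L[ℝ] J => f z) (quadCLM_of_mem hl (c.elem i))
    have h3 : r y = quadRep (l.val (c.elem i)) z := by rw [← hzy]; exact h2.symm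
    rw [h3]
    exact c.quadRep_mem_component (hsub _ (c.component_le i (c.elem_mem i))) hz
  have hv := hsub x (c.component_le i hx)
  set v := l.val x with hvx
  have hrv : r v = v := by
    change l.val (quadRep (c.elem i) (l⁻¹.val (l.val x))) = v
    rw [GLin.inv_val_apply, c.quadRep_elem_of_mem hx]
  have hry : ∀ j, r (quadRep (c.elem j) v) = quadRep (c.elem j) v := fun j => by
    conv_rhs => rw [← hrv, ← c.sum_quadRep_elem hv, map_sum, map_sum]
    rw [Finset.sum_eq_single j (fun m _ hm => c.quadRep_elem_of_mem_of_ne hm.symm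
      (hrj m _ (c.quadRep_elem_mem m v))) (by simp),
      c.quadRep_elem_of_mem (hrj j _ (c.quadRep_elem_mem j v))]
  have hzero : ∀ j, j ≠ i → quadRep (c.elem j) v = 0 := fun j hj => by
    by_contra hne
    have h1 := (r - quadCLM (c.elem i)).le_opNorm (quadRep (c.elem j) v)
    rw [_root_.sub_apply, hry, quadCLM_apply,
      c.quadRep_elem_of_mem_of_ne hj.symm (c.quadRep_elem_mem j v), sub_zero] at h1
    have h2 : 0 < ‖quadRep (c.elem j) v‖ := norm_pos_iff.2 hne
    nlinarith
  rw [← c.sum_quadRep_elem hv, Finset.sum_eq_single i (fun j _ hj => hzero j hj) (by simp)]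
  exact c.quadRep_elem_mem i v

theorem groupL_le_componentGroup : c.groupL ≤ c.componentGroup := by
  refine neutralComponent_le_of_eventually ?_
  have h1 : ∀ i, ∀ᶠ l in 𝓝 (1 : GLin J),
      ‖l.val * quadCLM (c.elem i) * l⁻¹.val - quadCLM (c.elem i)‖ < 1 := fun i => by
    have h2 : Continuous fun l : GLin J =>
        ‖l.val * quadCLM (c.elem i) * l⁻¹.val - quadCLM (c.elem i)‖ :=
      (((Units.continuous_val.mul continuous_const).mul
        (Units.continuous_val.comp continuous_inv)).sub continuous_const).norm
    refine h2.continuousAt.eventually (Iio_mem_nhds ?_)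
    simp
  filter_upwards [eventually_all.2 h1] with l hl hlc
  have h3 : ∀ j, ∀ x ∈ c.component j, l.val x ∈ c.component j := fun j x hx =>
    c.map_mem_component hlc (hl j) hx
  refine ⟨hlc, fun j x => ⟨fun hx => ?_, h3 j x⟩⟩
  obtain ⟨y, hy, hyx⟩ := Submodule.exists_mem_map_eq (A := l.val.toLinearMap)
    (injective_val l) (h3 j) hx
  rwa [← injective_val l hyx]

/-- The compression of an operator on `J` to `J_j`. -/
noncomputable def compress (j : Fin k) (A : J →L[ℝ] J) : c.component j →L[ℝ] c.component j :=
  ((quadCLM (c.elem j)).codRestrict (c.component j) (c.quadRep_elem_mem j)) ∘L A ∘L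
    (c.component j).subtypeL

theorem coe_compress {j : Fin k} {A : J →L[ℝ] J} {x : c.component j}
    (hA : A x ∈ c.component j) : (c.compress j A x : J) = A x :=
  c.quadRep_elem_of_mem hA

theorem continuous_compress (j : Fin k) : Continuous (c.compress j) :=
  continuous_const.clm_comp (continuous_id.clm_comp continuous_const)

/-- The restriction of the elements of `componentGroup` to `J_j`. -/
noncomputable def restrictHom (j : Fin k) : c.componentGroup →* GLin (c.component j) :=
  MonoidHom.toHomUnits
    { toFun := fun l => c.compress j l.val.val
      map_one' := ContinuousLinearMap.ext fun x => Subtype.ext (c.coe_compress x.2)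
      map_mul' := fun a b => ContinuousLinearMap.ext fun x => Subtype.ext (by
        have hb := (b.2.2 j x).2 x.2
        have h1 : (c.compress j b.val.val x : J) = b.val.val x := c.coe_compress hb
        have h2 : (c.compress j a.val.val (c.compress j b.val.val x) : J)
            = a.val.val (c.compress j b.val.val x : J) :=
          c.coe_compress ((a.2.2 j _).2 (c.compress j b.val.val x).2)
        rw [mul_apply_eq_comp, h2, h1]
        exact c.coe_compress ((a.2.2 j _).2 hb)) }

theorem coe_restrictHom {j : Fin k} (l : c.componentGroup) (x : c.component j) :
    ((c.restrictHom j l).val x : J) = l.val.val x :=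
  c.coe_compress ((l.2.2 j x).2 x.2)

/-- The equation of Str(J) restricts to J_j because P(ℓe) acts there as P(ℓc_j): the j-th component
of ℓe is ℓc_j. -/
theorem restrictHom_mem_structureGroup (j : Fin k) (l : c.componentGroup) :
    c.restrictHom j l ∈ EuclideanJordanAlgebra.structureGroup (c.component j) := by
  refine EuclideanJordanAlgebra.mem_structureGroup_iff.2 fun x => ?_
  ext y
  have hinv : ∀ z : c.component j,
      (((c.restrictHom j l)⁻¹).val z : J) = (l.val⁻¹).val (z : J) := fun z => by
    rw [← map_inv]
    exact c.coe_restrictHom l⁻¹ z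
  have h1 := congrArg (fun f : J →L[ℝ] J => f y) (quadCLM_of_mem l.2.1.1 (x : J))
  simp only [mul_apply_eq_comp, quadCLM_apply] at h1 ⊢
  have h2 : quadRep (l.val.val 1) (y : J) = quadRep (l.val.val (c.elem j)) (y : J) := by
    have h3 : quadRep (c.elem j) (l.val.val 1) = l.val.val (c.elem j) := by
      rw [← c.sum_eq_one, map_sum, map_sum, Finset.sum_eq_single j
        (fun i _ hi => c.quadRep_elem_of_mem_of_ne hi.symm ((l.2.2 i _).2 (c.elem_mem i)))
        (by simp), c.quadRep_elem_of_mem ((l.2.2 j _).2 (c.elem_mem j))]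
    rw [c.quadRep_of_mem_component ((c.mem_structureGroup_iff.1 l.2.1).2 1 c.one_mem_subalgebra)
      y.2, h3]
  rw [coe_quadRep, coe_restrictHom, coe_restrictHom, coe_quadRep, hinv, coe_quadRep,
    coe_restrictHom, h1, h2]
  rfl

theorem restrictHom_mem_groupL (j : Fin k) {l : GLin J} (hl : l ∈ c.groupL) :
    c.restrictHom j ⟨l, c.groupL_le_componentGroup hl⟩
      ∈ EuclideanJordanAlgebra.groupL (c.component j) := by
  let S : Set (GLin (c.component j)) :=
    {u | ∃ (l : GLin J) (hl : l ∈ c.groupL),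
      u = c.restrictHom j ⟨l, c.groupL_le_componentGroup hl⟩}
  -- Units carry the subspace topology of the operators, so connectedness is checked on the
  -- underlying operators, where compression is continuous.
  have hS : Units.val '' S = (fun l : GLin J => c.compress j l.val) '' (c.groupL : Set (GLin J)) := by
    ext A
    constructor
    · rintro ⟨_, ⟨l, hl, rfl⟩, rfl⟩
      exact ⟨l, hl, rfl⟩
    · rintro ⟨l, hl, rfl⟩
      exact ⟨_, ⟨l, hl, rfl⟩, rfl⟩
  have hconn : IsPreconnected S := by
    rw [← Units.isOpenEmbedding_val.isInducing.isPreconnected_image, hS]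
    exact (isPreconnected_neutralComponent _).image _
      ((c.continuous_compress j).comp Units.continuous_val).continuousOn
  refine subset_neutralComponent hconn ⟨1, one_mem _, ?_⟩ ?_ ⟨l, hl, rfl⟩
  · exact (map_one (c.restrictHom j)).symm
  · rintro _ ⟨l, hl, rfl⟩
    exact c.restrictHom_mem_structureGroup j _

/-- The restriction map `L(𝐜) → L_1 × ⋯ × L_k`. -/
noncomputable def res : c.groupL →* (∀ j, EuclideanJordanAlgebra.groupL (c.component j)) :=
  MonoidHom.pi fun j =>
    ((c.restrictHom j).comp (Subgroup.inclusion c.groupL_le_componentGroup)).codRestrict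
      (EuclideanJordanAlgebra.groupL (c.component j)) fun l => c.restrictHom_mem_groupL j l.2

theorem coe_res (l : c.groupL) (j : Fin k) (x : c.component j) :
    (((c.res l j).val.val x : c.component j) : J) = l.val.val (x : J) :=
  c.coe_restrictHom ⟨l.val, c.groupL_le_componentGroup l.2⟩ x

theorem ker_res : c.res.ker = c.groupM.subgroupOf c.groupL := by
  ext l
  rw [MonoidHom.mem_ker, Subgroup.mem_subgroupOf]
  constructor
  · intro h
    refine ⟨l.2, fun x hx => ?_⟩
    rw [← c.sum_quadRep_elem hx, map_sum]
    refine Finset.sum_congr rfl fun j _ => ?_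
    have h1 := c.coe_res l j ⟨_, c.quadRep_elem_mem j x⟩
    rw [h] at h1
    exact h1.symm
  · rintro ⟨_, h⟩
    funext j
    refine Subtype.ext (Units.ext (ContinuousLinearMap.ext fun x => Subtype.ext ?_))
    rw [coe_res, h x (c.component_le j x.2)]
    rfl

/-! ### Lifting from the factors, and generators of L(𝐜). -/

/-- P along the segment from e to y² is a path in Str(𝐜) starting at 1. Only y², not y, has to lie
in J(𝐜). -/
theorem mem_groupL_of_mem_cone {x : J} (hx : x ∈ c.cone) {g : GLin J} (hg : g.val = quadCLM x) :
    g ∈ c.groupL := by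
  obtain ⟨hxc, y, hy, rfl⟩ := hx
  let p : ℝ → J := fun t => (1 - t) • (1 : J) + t • (y * y)
  let S : Set (GLin J) := {u | ∃ t ∈ Set.Icc (0 : ℝ) 1, u.val = quadCLM (p t)}
  have hS : Units.val '' S = (fun t => quadCLM (p t)) '' Set.Icc (0 : ℝ) 1 := by
    ext A
    constructor
    · rintro ⟨u, ⟨t, ht, htu⟩, rfl⟩
      exact ⟨t, ht, htu.symm⟩
    · rintro ⟨t, ht, rfl⟩
      obtain ⟨u, hu⟩ := exists_unit_quadCLM (isInvertible_segment hy ht.1 ht.2)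
      exact ⟨u, ⟨t, ht, hu⟩, hu⟩
  have hconn : IsPreconnected S := by
    rw [← Units.isOpenEmbedding_val.isInducing.isPreconnected_image, hS]
    have hp : Continuous p := by fun_prop
    exact isPreconnected_Icc.image _ (continuous_quadCLM.comp hp).continuousOn
  refine subset_neutralComponent hconn ⟨0, by simp, ?_⟩ ?_ ⟨1, by simp, ?_⟩
  · simp [p, quadCLM_one]
  · rintro u ⟨t, _, hu⟩
    refine c.mem_structureGroup_iff.2 ⟨mem_structureGroup_of_eq_quadCLM hu, fun z hz => ?_⟩
    rw [hu]
    exact c.quadRep_mem_subalgebra (add_mem (Submodule.smul_mem _ _ c.one_mem_subalgebra)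
      (Submodule.smul_mem _ _ hxc)) hz
  · simp [p, hg]

/-- The subgroup generated by the `P(x)`, `x ∈ Ω(𝐜)`. -/
def quadGroup : Subgroup (GLin J) :=
  Subgroup.closure {g : GLin J | ∃ x ∈ c.cone, ∀ y : J, g.val y = quadRep x y}

theorem quadGroup_le_groupL : c.quadGroup ≤ c.groupL := by
  refine (Subgroup.closure_le _).2 ?_
  rintro g ⟨x, hx, hg⟩
  exact c.mem_groupL_of_mem_cone hx (ContinuousLinearMap.ext hg)

theorem exists_mem_cone {j : Fin k} {x : c.component j}
    (hx : x ∈ EuclideanJordanAlgebra.cone (c.component j)) :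
    (x : J) + (1 - c.elem j) ∈ c.cone := by
  have h1 : (1 : J) - c.elem j ∈ c.subalgebra :=
    sub_mem c.one_mem_subalgebra (c.component_le j (c.elem_mem j))
  refine ⟨add_mem (c.component_le j x.2) h1, ?_⟩
  obtain ⟨y, hy, rfl⟩ := hx
  have hsq : ((y : J) + (1 - c.elem j)) * ((y : J) + (1 - c.elem j))
      = (y : J) * y + (1 - c.elem j) := by
    have h2 : (1 - c.elem j) * (y : J) = 0 := by
      rw [sub_mul, one_mul, sub_eq_zero]; exact y.2.symm
    rw [add_mul, mul_add, mul_add, c.one_sub_elem_idem, mul_comm (y : J) (1 - c.elem j), h2]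
    abel
  have hw : (y : J) + (1 - c.elem j) ∈ c.subalgebra := add_mem (c.component_le j y.2) h1
  have hq : quadRep (c.elem j) ((y : J) + (1 - c.elem j)) = y := by
    rw [map_add, map_sub, quadRep_apply_one, c.quadRep_elem_of_mem y.2,
      c.quadRep_elem_of_mem (c.elem_mem j), c.idem, sub_self, add_zero]
  refine ⟨(y : J) + (1 - c.elem j), ?_, hsq.symm⟩
  rw [isInvertible_iff]
  -- For w = y + (e - c_j) the witness is y⁻² + (e - c_j), with y⁻¹ taken in J_j: P(w) sends y⁻² to
  -- c_j and e - c_j to w² - y² = e - c_j.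
  refine quadRep_injective_of_apply_eq_one
    (u := ((jinv y * jinv y : c.component j) : J) + (1 - c.elem j)) ?_
  have h3 : quadRep ((y : J) + (1 - c.elem j)) ((jinv y * jinv y : c.component j) : J)
      = c.elem j := by
    rw [c.quadRep_of_mem_component hw (jinv y * jinv y).2, hq, ← coe_quadRep, quadRep_jinv_sq hy]
    rfl
  have h4 : quadRep ((y : J) + (1 - c.elem j)) (c.elem j) = (y : J) * y := by
    rw [c.quadRep_of_mem_component hw (c.elem_mem j), hq]
    exact congrArg Subtype.val (quadRep_apply_one y)
  rw [map_add, map_sub, h3, h4, quadRep_apply_one, hsq]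
  abel

/-- A generator P(x) of the group of J_j extends as P(x + e - c_j), whose j-th component is x and
whose other components are the units c_i. -/
theorem exists_extension {j : Fin k} {u : GLin (c.component j)}
    (hu : u ∈ EuclideanJordanAlgebra.quadGroup (c.component j)) :
    ∃ l ∈ c.quadGroup, (∀ x : c.component j, l.val (x : J) = (u.val x : c.component j)) ∧
      ∀ i, i ≠ j → ∀ x ∈ c.component i, l.val x = x := by
  induction hu using Subgroup.closure_induction with
  | mem u hu =>
    obtain ⟨x, hx, hxu⟩ := hu
    have hc := c.exists_mem_cone hx
    obtain ⟨l, hl⟩ := exists_unit_quadCLM (isInvertible_of_mem_cone hc.2)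
    refine ⟨l, Subgroup.subset_closure ⟨_, hc, fun y => by rw [hl]; rfl⟩, fun z => ?_,
      fun i hi z hz => ?_⟩
    · rw [hl, hxu, quadCLM_apply, coe_quadRep, c.quadRep_of_mem_component hc.1 z.2, map_add,
        map_sub, quadRep_apply_one, c.quadRep_elem_of_mem x.2,
        c.quadRep_elem_of_mem (c.elem_mem j), c.idem, sub_self, add_zero]
    · rw [hl, quadCLM_apply, c.quadRep_of_mem_component hc.1 hz, map_add,
        map_sub, quadRep_apply_one, c.quadRep_elem_of_mem_of_ne hi x.2,
        c.quadRep_elem_of_mem_of_ne hi (c.elem_mem j), c.idem, sub_zero, zero_add,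
        c.quadRep_elem_of_mem hz]
  | one => exact ⟨1, one_mem _, fun _ => rfl, fun _ _ _ _ => rfl⟩
  | mul u v _ _ hu hv =>
    obtain ⟨l, hl, h1, h2⟩ := hu
    obtain ⟨m, hm, h3, h4⟩ := hv
    refine ⟨l * m, mul_mem hl hm, fun x => ?_, fun i hi x hx => ?_⟩
    · change l.val (m.val x) = (u.val (v.val x) : c.component j)
      rw [h3, h1]
    · change l.val (m.val x) = x
      rw [h4 i hi x hx, h2 i hi x hx]
  | inv u _ hu =>
    obtain ⟨l, hl, h1, h2⟩ := hu
    refine ⟨l⁻¹, inv_mem hl, fun x => ?_, fun i hi x hx => ?_⟩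
    · apply injective_val l
      rw [h1, GLin.val_inv_apply, GLin.val_inv_apply]
    · apply injective_val l
      rw [GLin.val_inv_apply, h2 i hi x hx]

theorem exists_mem_quadGroup_res_eq (g : ∀ j, EuclideanJordanAlgebra.groupL (c.component j)) :
    ∃ l : c.groupL, l.val ∈ c.quadGroup ∧ c.res l = g := by
  have h : g ∈ (c.quadGroup.subgroupOf c.groupL).map c.res := by
    -- The image is a subgroup of a finite product, so it suffices to lift tuples with a single
    -- nontrivial entry.
    refine Subgroup.pi_mem_of_mulSingle_mem g fun j => ?_
    obtain ⟨l, hl, h1, h2⟩ := c.exists_extension (groupL_le_quadGroup (g j).2)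
    refine ⟨⟨l, c.quadGroup_le_groupL hl⟩, hl, ?_⟩
    funext i
    refine Subtype.ext (Units.ext (ContinuousLinearMap.ext fun x => Subtype.ext ?_))
    rw [coe_res]
    rcases eq_or_ne i j with rfl | hi
    · rw [Pi.mulSingle_eq_same]
      exact h1 x
    · rw [Pi.mulSingle_eq_of_ne hi]
      exact h2 i hi x x.2
  obtain ⟨l, hl, hlg⟩ := h
  exact ⟨l, hl, hlg⟩

theorem exists_mem_groupL_of_mem_cone (x : J) (hx : x ∈ c.cone) :
    ∃ g ∈ c.groupL, ∀ y : J, g.val y = quadRep x y := by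
  obtain ⟨g, hg⟩ := exists_unit_quadCLM (isInvertible_of_mem_cone hx.2)
  exact ⟨g, c.mem_groupL_of_mem_cone hx hg, fun y => by rw [hg]; rfl⟩

/-- If m is a lift of the restriction of ℓ to a product of P(x)^{±1}, then m⁻¹ℓ ∈ M(𝐜). The
generated group is thus already all of L(𝐜); since L(𝐜) is closed, taking the closure adds nothing.
-/
theorem groupL_eq_topologicalClosure :
    c.groupL = (Subgroup.closure ({g : GLin J | ∃ x ∈ c.cone, ∀ y : J, g.val y = quadRep x y} ∪
      (c.groupM : Set (GLin J)))).topologicalClosure := by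
  refine le_antisymm (fun l hl => Subgroup.le_topologicalClosure _ ?_) ?_
  · obtain ⟨m, hm, hml⟩ := c.exists_mem_quadGroup_res_eq (c.res ⟨l, hl⟩)
    have h1 : m⁻¹ * ⟨l, hl⟩ ∈ c.res.ker := by
      rw [MonoidHom.mem_ker, map_mul, map_inv, hml, inv_mul_cancel]
    rw [c.ker_res, Subgroup.mem_subgroupOf] at h1
    have h2 := mul_mem (Subgroup.closure_mono Set.subset_union_left hm)
      (Subgroup.subset_closure (Set.mem_union_right _ h1))
    rwa [Subgroup.coe_mul, Subgroup.coe_inv, mul_inv_cancel_left] at h2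
  · refine Subgroup.topologicalClosure_minimal _ ?_
      (isClosed_neutralComponent c.isClosed_structureGroup)
    refine (Subgroup.closure_le _).2 (Set.union_subset ?_ fun g hg => hg.1)
    rintro g ⟨x, hx, hg⟩
    exact c.mem_groupL_of_mem_cone hx (ContinuousLinearMap.ext hg)

end CSOI

end EuclideanJordanAlgebra

theorem proposition1 {J : Type*} [NormedAddCommGroup J] [InnerProductSpace ℝ J]
    [EuclideanJordanAlgebra J] {k : ℕ} (c : EuclideanJordanAlgebra.CSOI J k) :
    -- the restriction map `ℓ ↦ (ℓ_1, …, ℓ_k)` is a well-defined surjective homomorphism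
    -- `L(𝐜) → L_1 × ⋯ × L_k` with kernel `M(𝐜)`
    (∃ res : c.groupL →* (∀ j, EuclideanJordanAlgebra.groupL (c.component j)),
      (∀ (l : c.groupL) (j : Fin k) (x : c.component j),
        (((res l j).val.val x : c.component j) : J) = l.val.val (x : J)) ∧
      Function.Surjective res ∧
      res.ker = c.groupM.subgroupOf c.groupL) ∧
    -- `P(x) ∈ L(𝐜)` for `x ∈ Ω(𝐜)`, and `L(𝐜)` is contained in `L`
    (∀ x ∈ c.cone, ∃ g ∈ c.groupL, ∀ y : J, g.val y = EuclideanJordanAlgebra.quadRep x y) ∧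
    c.groupL ≤ EuclideanJordanAlgebra.groupL J ∧
    -- `L(𝐜)` is the closed subgroup generated by the `P(x)`, `x ∈ Ω(𝐜)`, and `M(𝐜)`
    c.groupL = (Subgroup.closure
      ({g : EuclideanJordanAlgebra.GLin J |
          ∃ x ∈ c.cone, ∀ y : J, g.val y = EuclideanJordanAlgebra.quadRep x y} ∪
        (c.groupM : Set (EuclideanJordanAlgebra.GLin J)))).topologicalClosure :=
  ⟨⟨c.res, c.coe_res, fun g => (c.exists_mem_quadGroup_res_eq g).imp fun _ h => h.2, c.ker_res⟩,
    c.exists_mem_groupL_of_mem_cone, c.groupL_le, c.groupL_eq_topologicalClosure⟩
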